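/- Let $L,R,\alpha,\beta$ be positive constants and $0<d<\pi/2$, and put $\mathscr D_d=\{\zeta\in\mathbb C:|\operatorname{Im}\zeta|<d\}$. Let $F$ be analytic in $\mathscr D_d$ with $$|F(\zeta)|\le\frac{L}{|1+e^{-\pi\sinh\zeta}|^{\alpha}\,|1+e^{\pi\sinh\zeta}|^{\beta}}\quad(\zeta\in\mathscr D_d),\qquad |F(x)|\le\frac{R}{(1+e^{-\pi\sinh x})^{\alpha}(1+e^{\pi\sinh x})^{\beta}}\quad(x\in\mathbb R).$$ Let $\mu=\min\{\alpha,\beta\}$, $q(x)=x/\operatorname{arsinh}x$, and $\operatorname{sinc}x=\sin(\pi x)/(\pi x)$ with $\operatorname{sinc}0=1$. For a real parameter $n\ge1$ (in particular for every positive integer $n$) let $$h=\frac{\operatorname{arsinh}(dn/\mu)}{n},\qquad M=\left\lceil\frac1h\operatorname{arsinh}\!\left(\frac{\mu}{\alpha}\,q\!\left(\frac{dn}{\mu}\right)\right)\right\rceil,\qquad N=\left\lceil\frac1h\operatorname{arsinh}\!\left(\frac{\mu}{\beta}\,q\!\left(\frac{dn}{\mu}\right)\right)\right\rceil,$$ and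 write $S_k(x)=F(kh)\operatorname{sinc}\!\left(\frac{x-kh}{h}\right)$ and $$A=\frac{2L}{\pi\mu\,(1-e^{-2\pi\mu q(d/\mu)})\cos^{\alpha+\beta}\!\left(\frac{\pi}{2}\sin d\right)\cos d}.$$ Then, for every such $n$, the series $\sum_{k\in\mathbb Z}S_k(x)$ converges absolutely for every real $x$, and the discretization and truncation errors satisfy $$\sup_{x\in\mathbb R}\Big|F(x)-\sum_{k=-\infty}^{\infty}S_k(x)\Big|\le\frac{2}{\pi d}\,A\,e^{-\pi d/h},\qquad \sup_{x\in\mathbb R}\Big|\sum_{k=-\infty}^{-M-1}S_k(x)+\sum_{k=N+1}^{\infty}S_k(x)\Big|\le\frac{2}{\pi d}\,R\,e^{-\pi\mu q(dn/\mu)},$$ where both rates are exactly the same: $e^{-\pi d/h}=e^{-\pi\mu q(dn/\mu)}=e^{-\pi dn/\operatorname{arsinh}(dn/\mu)}$. Moreover $$\sup_{x\in\mathbb R}\Big|F(x)-\sum_{k=-M}^{N}S_k(x)\Big|\le C\,e^{-\pi dn/\operatorname{arsinh}(dn/\mu)},\qquad C=\frac{2}{\pi d}\,[A+R],$$ with $C$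 independent of $n$. Finally, both $M<n$ and $N<n$ hold for all sufficiently large $n$. -/

import Mathlib

open Real

noncomputable section

namespace DESinc

/-- The strip `{ζ : |Im ζ| < d}` in the complex plane. -/
def strip (d : ℝ) : Set ℂ := {ζ : ℂ | |ζ.im| < d}

/-- The family of functions that are analytic in the strip of half-width `d` and decay double
exponentially there, with constant `L` in the strip and constant `R` on the real line. -/
structure MemLDE (L R α β d : ℝ) (F : ℂ → ℂ) : Prop where
  analytic : AnalyticOnNhd ℂ F (strip d)
  bound_strip : ∀ ζ ∈ strip d,
    ‖F ζ‖ ≤ L / (‖1 + Complex.exp (-(π * Complex.sinh ζ))‖ ^ α *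
      ‖1 + Complex.exp (π * Complex.sinh ζ)‖ ^ β)
  bound_real : ∀ x : ℝ,
    ‖F x‖ ≤ R / ((1 + exp (-(π * sinh x))) ^ α * (1 + exp (π * sinh x)) ^ β)

/-- The normalized cardinal sine `sin (π x) / (π x)`, equal to `1` at `x = 0`. -/
def nsinc (x : ℝ) : ℝ := Real.sinc (π * x)

/-- The `k`-th term `F (k h) sinc ((x - k h) / h)` of the cardinal series of `F`. -/
def sincTerm (F : ℂ → ℂ) (h x : ℝ) (k : ℤ) : ℂ :=
  F ((k * h : ℝ) : ℂ) * (nsinc ((x - k * h) / h) : ℂ)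

/-- `|F x - ∑_{k = -M}^{N} F (k h) sinc ((x - k h) / h)|`. -/
def totalErr (F : ℂ → ℂ) (h : ℝ) (M N : ℤ) (x : ℝ) : ℝ :=
  ‖F x - ∑ k ∈ Finset.Icc (-M) N, sincTerm F h x k‖

/-- The discretization error `|F x - ∑_{k ∈ ℤ} F (k h) sinc ((x - k h) / h)|`. -/
def discErr (F : ℂ → ℂ) (h x : ℝ) : ℝ :=
  ‖F x - ∑' k : ℤ, sincTerm F h x k‖

/-- The truncation error: the modulus of the sum of the terms with `k ≤ -M - 1` and of those
with `k ≥ N + 1`. -/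
def truncErr (F : ℂ → ℂ) (h : ℝ) (M N : ℤ) (x : ℝ) : ℝ :=
  ‖(∑' k : Set.Iic (-M - 1), sincTerm F h x k) + ∑' k : Set.Ici (N + 1), sincTerm F h x k‖

/-- `q x = x / arsinh x`. -/
def q (x : ℝ) : ℝ := x / arsinh x

/-- The mesh size `h = arsinh (d n / μ) / n`. -/
def mesh (d μ n : ℝ) : ℝ := arsinh (d * n / μ) / n

/-- The truncation number `⌈(1 / h) arsinh ((μ / γ) q (d n / μ))⌉`;
`γ = α` gives `M` and `γ = β` gives `N`. -/
def truncNum (d μ γ n : ℝ) : ℤ :=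
  ⌈1 / mesh d μ n * arsinh (μ / γ * q (d * n / μ))⌉

/-- `2 L / (π μ (1 - e^{-2 π μ q(d/μ)}) cos^{α+β} ((π/2) sin d) cos d)`, with `μ = min α β`. -/
def discConst (L α β d : ℝ) : ℝ :=
  2 * L / (π * min α β * (1 - exp (-(2 * π * min α β * q (d / min α β)))) *
    cos (π / 2 * sin d) ^ (α + β) * cos d)

/-- The constant of the total error bound. -/
def totalConst (L R α β d : ℝ) : ℝ :=
  2 / (π * d) * (discConst L α β d + R)

end DESinc

end

noncomputable section

namespace DESinc

/-! ### Lower bounds for `1 + exp (±π sinh ζ)` in the strip -/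

section

/-! The hypothesis in the strip becomes usable decay through the sharp inequality
`le_norm_one_add_exp_pi_sinh`: at height y, |1 + e^{π sinh(x+iy)}| is at least cos((π/2) sin y)
times its value with the phase removed, 1 + e^{π sinh x cos y}. Hence |F(t+iy)| is at most L /
cos^{α+β}((π/2) sin y) times exp(-πμ cos y |sinh t|), whose integral over a horizontal line is at
most 2/(πμ cos y) times that prefactor.

The discretization error is a contour integral: the residues of F(z) / ((z-x) sin(πz/h)) at x and at
the mesh points are, up to the factor sin(πx/h), F(x) and the negatives of the terms of the cardinal
series (`sin_mul_rectIntegral`). The vertical sides vanish as the rectangle widens, the horizontal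
ones contribute 1/sinh(πy/h), and y tends to d. Since d/h = μ q(dn/μ) ≥ μ q(d/μ), replacing 1/sinh
by an exponential costs only the factor 1 - e^{-2πμ q(d/μ)}.

For the truncation error, exp(-a sinh(kh)) is dominated by a telescoping difference, which yields a
factor 1/(a h cosh(Nh)). The choice of N gives β sinh(Nh) ≥ d/h, hence β h cosh(Nh) ≥ d: the factor
1/h is absorbed, and each tail is at most R/(πd) e^{-πd/h}. The total error is the sum of the two.
-/

theorem sin_sub_le_mul_cos {a b : ℝ} (ha : 0 ≤ a) (hab : a ≤ b) (hb : b ≤ π) :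
    sin b ≤ sin a + (b - a) * cos a := by
  rcases hab.eq_or_lt with rfl | hlt
  · simp
  · obtain ⟨c, hc, hc'⟩ := exists_deriv_eq_slope sin hlt continuous_sin.continuousOn
      differentiable_sin.differentiableOn
    rw [Real.deriv_sin, eq_div_iff (by linarith)] at hc'
    have : cos c ≤ cos a :=
      cos_le_cos_of_nonneg_of_le_pi ha (by linarith [hc.2]) hc.1.le
    nlinarith

/-- Product of cos a ≤ π/2 - a and Jordan's inequality in the weakened form a ≤ (π/2 + a) sin a. -/
theorem mul_cos_le_mul_sin {a : ℝ} (ha : 0 ≤ a) (ha' : a ≤ π / 2) :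
    a * cos a ≤ (π ^ 2 / 4 - a ^ 2) * sin a := by
  have h1 : cos a ≤ π / 2 - a := by
    rw [← sin_pi_div_two_sub]; exact sin_le (by linarith)
  have h2 : a ≤ (π / 2 + a) * sin a := by
    have := mul_le_sin ha ha'
    calc a = π / 2 * (2 / π * a) := by field_simp
      _ ≤ π / 2 * sin a := by gcongr
      _ ≤ (π / 2 + a) * sin a := by
        have : 0 ≤ sin a := sin_nonneg_of_nonneg_of_le_pi ha (by linarith)
        nlinarith
  nlinarith

theorem one_add_sq_div_two_le_cosh (x : ℝ) : 1 + x ^ 2 / 2 ≤ cosh x := by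
  have h1 : cosh x = 1 + 2 * sinh (x / 2) ^ 2 := by
    have := cosh_two_mul (x / 2)
    rw [show 2 * (x / 2) = x by ring] at this
    rw [this, cosh_sq]; ring
  have h2 : (x / 2) ^ 2 ≤ sinh (x / 2) ^ 2 := by
    rw [sq_le_sq]
    rcases le_total 0 (x / 2) with h | h
    · have := self_le_sinh_iff.2 h
      rw [abs_of_nonneg h, abs_of_nonneg (by linarith)]; exact this
    · have := sinh_le_self_iff.2 h
      rw [abs_of_nonpos h, abs_of_nonpos (by linarith)]; linarith
  rw [h1]; linarith

/-- While `a cosh x ≤ π / 2`, the sine grows at most as fast as the hyperbolic cosine. -/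
theorem sin_mul_cosh_le_of_mul_cosh_le {a w x : ℝ} (ha : 0 ≤ a) (ha' : a ≤ π / 2)
    (hw : w ^ 2 = π ^ 2 / 4 - a ^ 2) (hx : a * cosh x ≤ π / 2) :
    sin (a * cosh x) ≤ sin a * cosh (w * sinh x) := by
  have hc := one_le_cosh x
  -- Concavity: the sine lies below its tangent at a.
  have h1 := sin_sub_le_mul_cos ha (by nlinarith : a ≤ a * cosh x) (by linarith [pi_pos])
  have h2 := mul_cos_le_mul_sin ha ha'
  have h3 := one_add_sq_div_two_le_cosh (w * sinh x)
  have hs : 0 ≤ sin a := sin_nonneg_of_nonneg_of_le_pi ha (by linarith [pi_pos])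
  -- Here sinh² = (cosh - 1)(cosh + 1) ≥ 2(cosh - 1).
  have h4 : (π ^ 2 / 4 - a ^ 2) * (cosh x - 1) ≤ (w * sinh x) ^ 2 / 2 := by
    rw [mul_pow, hw, sinh_sq]
    have : 0 ≤ π ^ 2 / 4 - a ^ 2 := hw ▸ sq_nonneg w
    nlinarith [mul_nonneg this (sq_nonneg (cosh x - 1))]
  calc sin (a * cosh x) ≤ sin a + (cosh x - 1) * (a * cos a) := by linarith
    _ ≤ sin a + (cosh x - 1) * ((π ^ 2 / 4 - a ^ 2) * sin a) := by gcongr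
    _ = sin a * (1 + (π ^ 2 / 4 - a ^ 2) * (cosh x - 1)) := by ring
    _ ≤ sin a * cosh (w * sinh x) := by gcongr; linarith

theorem abs_sin_mul_cosh_le {a w : ℝ} (ha : 0 ≤ a) (ha' : a ≤ π / 2) (hw0 : 0 ≤ w)
    (hw : w ^ 2 = π ^ 2 / 4 - a ^ 2) (x : ℝ) :
    |sin (a * cosh x)| ≤ sin a * cosh (w * sinh x) := by
  wlog hx0 : 0 ≤ x generalizing x
  · simpa using this (-x) (by linarith)
  rcases le_total (a * cosh x) (π / 2) with h | h
  · rw [abs_of_nonneg (sin_nonneg_of_nonneg_of_le_pi (by positivity) (by linarith [pi_pos]))]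
    exact sin_mul_cosh_le_of_mul_cosh_le ha ha' hw h
  -- At the first passage of a cosh through π/2 the sine is 1, so the right side has reached 1; it
  -- only increases afterwards.
  · obtain ⟨y, hy, hy'⟩ : ∃ y ∈ Set.Icc 0 x, a * cosh y = π / 2 := by
      have hcont : ContinuousOn (fun y => a * cosh y) (Set.Icc 0 x) :=
        (continuous_const.mul continuous_cosh).continuousOn
      exact intermediate_value_Icc hx0 hcont ⟨by simpa using ha', h⟩
    have h1 := sin_mul_cosh_le_of_mul_cosh_le ha ha' hw hy'.le
    rw [hy', sin_pi_div_two] at h1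
    have hs : 0 ≤ sin a := sin_nonneg_of_nonneg_of_le_pi ha (by linarith [pi_pos])
    have h2 : cosh (w * sinh y) ≤ cosh (w * sinh x) := by
      have hy0 : 0 ≤ sinh y := sinh_nonneg_iff.2 hy.1
      have : sinh y ≤ sinh x := sinh_le_sinh.2 hy.2
      rw [cosh_le_cosh, abs_of_nonneg (by positivity), abs_of_nonneg (by positivity)]
      gcongr
    calc |sin (a * cosh x)| ≤ 1 := abs_sin_le_one _
      _ ≤ _ := h1
      _ ≤ _ := by gcongr

/-- The squared modulus is (1 + e^a)² - 4e^a sin²(b/2), and 4e^a cosh²(a/2) = (1 + e^a)². -/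
theorem norm_one_add_exp_sq (a b : ℝ) :
    ‖1 + Complex.exp (a + b * Complex.I)‖ ^ 2 =
      (1 + exp a) ^ 2 * (1 - (sin (b / 2) / cosh (a / 2)) ^ 2) := by
  have h1 : cosh (a / 2) ^ 2 * (4 * exp a) = (1 + exp a) ^ 2 := by
    have e : exp a = exp (a / 2) ^ 2 := by rw [← exp_nat_mul]; congr 1; push_cast; ring
    rw [cosh_eq, exp_neg, e]; field_simp; ring
  have h2 : cos b = 1 - 2 * sin (b / 2) ^ 2 := by
    have := cos_two_mul (b / 2)
    rw [show 2 * (b / 2) = b by ring, cos_sq'] at this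
    rw [this]; ring
  have h3 : (1 + exp a) ^ 2 * (1 - (sin (b / 2) / cosh (a / 2)) ^ 2) =
      (1 + exp a) ^ 2 - 4 * exp a * sin (b / 2) ^ 2 := by
    have := (cosh_pos (a / 2)).ne'
    rw [← h1]; field_simp
  rw [h3, Complex.exp_add_mul_I, ← Complex.ofReal_exp, ← Complex.ofReal_cos, ← Complex.ofReal_sin,
    Complex.sq_norm, Complex.normSq_apply]
  simp only [Complex.add_re, Complex.add_im, Complex.mul_re, Complex.mul_im, Complex.one_re,
    Complex.one_im, Complex.ofReal_re, Complex.ofReal_im, Complex.I_re, Complex.I_im]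
  have := sin_sq_add_cos_sq b
  linear_combination (exp a) ^ 2 * this + 2 * exp a * h2

theorem le_norm_one_add_exp_pi_sinh {y : ℝ} (hy : |y| ≤ π / 2) (x : ℝ) :
    (1 + exp (π * sinh x * cos y)) * cos (π / 2 * sin y) ≤
      ‖1 + Complex.exp (π * Complex.sinh (x + y * Complex.I))‖ := by
  have hcy : 0 ≤ cos y := cos_nonneg_of_neg_pi_div_two_le_of_le (abs_le.1 hy).1 (abs_le.1 hy).2
  have e : (π : ℂ) * Complex.sinh (x + y * Complex.I) =
      ((π * sinh x * cos y : ℝ) : ℂ) + ((π * cosh x * sin y : ℝ) : ℂ) * Complex.I := by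
    rw [Complex.sinh_add, Complex.sinh_mul_I, Complex.cosh_mul_I]
    push_cast; ring
  rw [e]
  refine le_of_sq_le_sq ?_ (norm_nonneg _)
  rw [norm_one_add_exp_sq, mul_pow, cos_sq']
  refine mul_le_mul_of_nonneg_left ?_ (sq_nonneg _)
  rw [sub_le_sub_iff_left, div_pow, div_le_iff₀ (by positivity), ← mul_pow]
  -- The point (w, a) lies on the circle of radius π/2, as the sine inequality requires.
  have key := abs_sin_mul_cosh_le (a := π / 2 * |sin y|) (w := π / 2 * cos y) (by positivity)
    (by nlinarith [abs_sin_le_one y, pi_pos]) (by positivity)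
    (by rw [mul_pow, mul_pow, sq_abs, cos_sq']; ring) x
  have h1 : |sin (π / 2 * |sin y| * cosh x)| = |sin (π * cosh x * sin y / 2)| := by
    rcases abs_cases (sin y) with ⟨h, -⟩ | ⟨h, -⟩ <;> rw [h]
    · congr 2; ring
    · rw [← abs_neg, ← sin_neg]; congr 2; ring
  have h2 : sin (π / 2 * |sin y|) ^ 2 = sin (π / 2 * sin y) ^ 2 := by
    rcases abs_cases (sin y) with ⟨h, -⟩ | ⟨h, -⟩ <;> rw [h]
    rw [mul_neg, sin_neg, neg_sq]
  rw [h1] at key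
  calc sin (π * cosh x * sin y / 2) ^ 2 = |sin (π * cosh x * sin y / 2)| ^ 2 := (sq_abs _).symm
    _ ≤ (sin (π / 2 * |sin y|) * cosh (π / 2 * cos y * sinh x)) ^ 2 := by gcongr
    _ = (sin (π / 2 * sin y) * cosh (π * sinh x * cos y / 2)) ^ 2 := by
      rw [mul_pow, mul_pow, h2]; congr 3; ring

theorem le_norm_one_add_exp_neg_pi_sinh {y : ℝ} (hy : |y| ≤ π / 2) (x : ℝ) :
    (1 + exp (-(π * sinh x * cos y))) * cos (π / 2 * sin y) ≤
      ‖1 + Complex.exp (-(π * Complex.sinh (x + y * Complex.I)))‖ := by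
  have := le_norm_one_add_exp_pi_sinh (y := -y) (by simpa using hy) (-x)
  rw [sinh_neg, cos_neg, sin_neg, mul_neg, mul_neg, neg_mul, cos_neg] at this
  convert this using 4
  rw [← mul_neg, ← Complex.sinh_neg]; congr 2; push_cast; ring

end

/-! ### Tails of double exponential series, monotonicity of `q`, size of the truncation numbers -/

section

theorem norm_tsum_le_of_norm_le_sub {f : ℕ → ℂ} {t : ℕ → ℝ} (ht : ∀ j, 0 ≤ t j)
    (hf : ∀ j, ‖f j‖ ≤ t j - t (j + 1)) : Summable (fun j => ‖f j‖) ∧ ‖∑' j, f j‖ ≤ t 0 := by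
  have h1 : ∀ n, ∑ j ∈ Finset.range n, ‖f j‖ ≤ t 0 := fun n => by
    calc ∑ j ∈ Finset.range n, ‖f j‖ ≤ ∑ j ∈ Finset.range n, (t j - t (j + 1)) :=
          Finset.sum_le_sum fun j _ => hf j
      _ = t 0 - t n := Finset.sum_range_sub' t n
      _ ≤ t 0 := by linarith [ht n]
  have h2 : Summable (fun j => ‖f j‖) := summable_of_sum_range_le (fun j => norm_nonneg _) h1
  exact ⟨h2, (norm_tsum_le_tsum_norm h2).trans
    (Real.tsum_le_of_sum_range_le (fun j => norm_nonneg _) h1)⟩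

/-- Convexity gives sinh(x+h) ≥ sinh x + h cosh x; then e^u ≥ 1 + u. This makes the tails telescope
while keeping the gain a h cosh x. -/
theorem mul_exp_neg_sinh_le_sub {a h x : ℝ} (ha : 0 ≤ a) (hh : 0 ≤ h) (hx : 0 ≤ x) :
    a * h * cosh x * exp (-(a * sinh (x + h))) ≤
      exp (-(a * sinh x)) - exp (-(a * sinh (x + h))) := by
  have h1 : sinh x + h * cosh x ≤ sinh (x + h) := by
    rw [sinh_add]
    have e1 := self_le_sinh_iff.2 hh
    have e2 := one_le_cosh h
    have e3 := sinh_nonneg_iff.2 hx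
    have e4 := cosh_pos x
    nlinarith
  have h2 : exp (-(a * sinh x)) =
      exp (-(a * sinh (x + h))) * exp (a * sinh (x + h) - a * sinh x) := by
    rw [← exp_add]; congr 1; ring
  have h3 := add_one_le_exp (a * sinh (x + h) - a * sinh x)
  have h4 := exp_pos (-(a * sinh (x + h)))
  have h5 := mul_le_mul_of_nonneg_left h1 ha
  rw [h2]
  nlinarith

theorem tail_bound {f : ℤ → ℂ} {R a h : ℝ} (hR : 0 ≤ R) (ha : 0 < a) (hh : 0 < h) {N : ℤ}
    (hN : 0 ≤ N) (hf : ∀ k, N + 1 ≤ k → ‖f k‖ ≤ R * exp (-(a * sinh (k * h)))) :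
    Summable (fun j : ℕ => ‖f (N + 1 + j)‖) ∧
      ‖∑' j : ℕ, f (N + 1 + j)‖ ≤ R / (a * h * cosh (N * h)) * exp (-(a * sinh (N * h))) := by
  have hc : 0 < a * h * cosh (N * h) := mul_pos (mul_pos ha hh) (cosh_pos _)
  have key := norm_tsum_le_of_norm_le_sub (f := fun j : ℕ => f (N + 1 + j))
    (t := fun j : ℕ => R / (a * h * cosh (N * h)) * exp (-(a * sinh ((N + j) * h))))
    (fun j => by positivity) (fun j => by
      refine (hf _ (by omega)).trans ?_
      have hN' : (0 : ℝ) ≤ N := by exact_mod_cast hN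
      have h1 := mul_exp_neg_sinh_le_sub (a := a) (x := (N + j) * h) ha.le hh.le (by positivity)
      have h2 : cosh (N * h) ≤ cosh ((N + j) * h) := by
        rw [cosh_le_cosh, abs_of_nonneg (by positivity), abs_of_nonneg (by positivity)]
        nlinarith [(Nat.cast_nonneg j : (0 : ℝ) ≤ j)]
      have e1 : ((N : ℝ) + j) * h + h = (((N + 1 + j : ℤ)) : ℝ) * h := by push_cast; ring
      have e2 : ((N : ℝ) + ((j + 1 : ℕ) : ℝ)) * h = (((N + 1 + j : ℤ)) : ℝ) * h := by
        push_cast; ring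
      rw [e2, ← mul_sub, div_mul_eq_mul_div, le_div_iff₀ hc]
      rw [e1] at h1
      have h3 : a * h * cosh (N * h) * exp (-(a * sinh ((N + 1 + j : ℤ) * h))) ≤
          a * h * cosh ((N + j) * h) * exp (-(a * sinh ((N + 1 + j : ℤ) * h))) := by gcongr
      calc _ = R * (a * h * cosh (N * h) * exp (-(a * sinh ((N + 1 + j : ℤ) * h)))) := by ring
        _ ≤ _ := by gcongr; exact h3.trans h1)
  simpa using key

/-- The natural numbers enumerate the integers above a given one. -/
def natEquivIci (m : ℤ) : ℕ ≃ Set.Ici m where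
  toFun j := ⟨m + j, by simp⟩
  invFun k := (k.1 - m).toNat
  left_inv j := by simp
  right_inv k := Subtype.ext (by
    have : m ≤ k.1 := k.2
    show m + ((k.1 - m).toNat : ℤ) = k.1
    omega)

/-- The natural numbers enumerate the integers below a given one. -/
def natEquivIic (m : ℤ) : ℕ ≃ Set.Iic m where
  toFun j := ⟨m - j, by simp⟩
  invFun k := (m - k.1).toNat
  left_inv j := by simp
  right_inv k := Subtype.ext (by
    have : k.1 ≤ m := k.2
    show m - ((m - k.1).toNat : ℤ) = k.1
    omega)

theorem norm_tsum_Ici_le {f : ℤ → ℂ} {R a h : ℝ} (hR : 0 ≤ R) (ha : 0 < a) (hh : 0 < h) {N : ℤ}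
    (hN : 0 ≤ N) (hf : ∀ k, N + 1 ≤ k → ‖f k‖ ≤ R * exp (-(a * sinh (k * h)))) :
    ‖∑' k : Set.Ici (N + 1), f k‖ ≤ R / (a * h * cosh (N * h)) * exp (-(a * sinh (N * h))) := by
  rw [← (natEquivIci (N + 1)).tsum_eq]
  exact (tail_bound hR ha hh hN hf).2

theorem norm_tsum_Iic_le {f : ℤ → ℂ} {R a h : ℝ} (hR : 0 ≤ R) (ha : 0 < a) (hh : 0 < h) {M : ℤ}
    (hM : 0 ≤ M) (hf : ∀ k, k ≤ -M - 1 → ‖f k‖ ≤ R * exp (a * sinh (k * h))) :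
    ‖∑' k : Set.Iic (-M - 1), f k‖ ≤ R / (a * h * cosh (M * h)) * exp (-(a * sinh (M * h))) := by
  rw [← (natEquivIic (-M - 1)).tsum_eq]
  convert (tail_bound (f := fun k => f (-k)) hR ha hh hM fun k hk => ?_).2 using 4 with j
  · simp only [natEquivIic, Equiv.coe_fn_mk]; congr 1; ring
  · refine (hf (-k) (by omega)).trans_eq ?_
    push_cast
    rw [neg_mul, sinh_neg, mul_neg]

theorem summable_of_norm_le_exp_sinh {f : ℤ → ℂ} {R a b h : ℝ} (hR : 0 ≤ R) (ha : 0 < a)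
    (hb : 0 < b) (hh : 0 < h) (hf : ∀ k : ℤ, ‖f k‖ ≤ R * exp (a * sinh (k * h)))
    (hf' : ∀ k : ℤ, ‖f k‖ ≤ R * exp (-(b * sinh (k * h)))) : Summable f := by
  refine Summable.of_nat_of_neg_add_one ?_ ?_
  · rw [← summable_nat_add_iff 1]
    convert (tail_bound (N := 0) hR hb hh le_rfl fun k _ => hf' k).1.of_norm using 2 with j
    congr 1; push_cast; ring
  · have := (tail_bound (f := fun k => f (-k)) (N := 0) hR ha hh le_rfl fun k _ => ?_).1.of_norm
    · refine this.congr fun j => ?_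
      show f (-(0 + 1 + j)) = f (-(j + 1))
      congr 1; ring
    · refine (hf (-k)).trans_eq ?_
      push_cast
      rw [neg_mul, sinh_neg, mul_neg]

theorem mul_sinh_le_sinh_mul {n y : ℝ} (hn : 1 ≤ n) (hy : 0 ≤ y) : n * sinh y ≤ sinh (n * y) := by
  have hconv : ConvexOn ℝ (Set.Ici 0) sinh := by
    refine MonotoneOn.convexOn_of_deriv (convex_Ici 0) continuous_sinh.continuousOn
      differentiable_sinh.differentiableOn ?_
    rw [Real.deriv_sinh, interior_Ici]
    intro a ha b hb hab
    rw [cosh_le_cosh, abs_of_pos ha, abs_of_pos hb]; exact hab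
  have hn0 : 0 < n := by linarith
  have := hconv.2 (Set.mem_Ici.2 (by positivity : 0 ≤ n * y)) Set.self_mem_Ici
    (show 0 ≤ 1 / n by positivity)
    (show 0 ≤ 1 - 1 / n by rw [sub_nonneg, div_le_one hn0]; exact hn) (by ring)
  simp only [smul_eq_mul, mul_zero, add_zero, sinh_zero] at this
  rw [show 1 / n * (n * y) = y by field_simp] at this
  calc n * sinh y ≤ n * (1 / n * sinh (n * y)) := by gcongr
    _ = _ := by field_simp

/-- Equivalent to arsinh(nx) ≤ n arsinh x, which follows from convexity of sinh. It makes the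
discretization constant independent of n. -/
theorem q_le_q_mul {n x : ℝ} (hn : 1 ≤ n) (hx : 0 < x) : q x ≤ q (n * x) := by
  have hn0 : 0 < n := by linarith
  have h1 : arsinh (n * x) ≤ n * arsinh x := by
    rw [← sinh_le_sinh, sinh_arsinh]
    simpa using mul_sinh_le_sinh_mul hn (arsinh_nonneg_iff.2 hx.le)
  have h2 : 0 < arsinh x := arsinh_pos_iff.2 hx
  have h3 : 0 < arsinh (n * x) := arsinh_pos_iff.2 (by positivity)
  unfold q
  rw [div_le_div_iff₀ h2 h3]
  nlinarith

theorem tendsto_arsinh_atTop : Filter.Tendsto arsinh Filter.atTop Filter.atTop :=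
  sinhOrderIso.symm.tendsto_atTop

theorem eventually_mul_le_sinh (c : ℝ) : ∀ᶠ x in Filter.atTop, c * x ≤ sinh x := by
  have h1 := (isLittleO_pow_exp_atTop (n := 1)).bound (c := 1 / (4 * (|c| + 1))) (by positivity)
  filter_upwards [h1, Filter.eventually_ge_atTop 1] with x hx hx1
  rw [pow_one, norm_of_nonneg (by linarith), norm_of_nonneg (exp_pos _).le, div_mul_eq_mul_div,
    one_mul, le_div_iff₀ (by positivity)] at hx
  have h2 : exp (-x) ≤ 1 := exp_le_one_iff.2 (by linarith)
  rw [sinh_eq]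
  nlinarith [le_abs_self c, abs_nonneg c]

/-- A unit shift changes sinh by a factor of at most 2e here, and 2e < 9 ≤ y. -/
theorem eventually_sinh_div_le_sinh_sub_one :
    ∀ᶠ y in Filter.atTop, sinh y / y ≤ sinh (y - 1) := by
  filter_upwards [Filter.eventually_ge_atTop 9] with y hy
  have h1 : sinh y = sinh (y - 1) * cosh 1 + cosh (y - 1) * sinh 1 := by
    rw [← sinh_add]; congr 1; ring
  have h2 : cosh (y - 1) ≤ 2 * sinh (y - 1) := by
    have e1 := cosh_sub_sinh (y - 1)
    have e2 : exp (-(y - 1)) ≤ 1 := exp_le_one_iff.2 (by linarith)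
    have e3 := self_le_sinh_iff.2 (show 0 ≤ y - 1 by linarith)
    linarith
  have h3 := cosh_add_sinh 1
  have h4 := exp_one_lt_d9
  have h5 : 0 ≤ sinh (y - 1) := sinh_nonneg_iff.2 (by linarith)
  have h6 : 0 ≤ sinh 1 := sinh_nonneg_iff.2 (by linarith)
  have h7 := cosh_pos 1
  rw [div_le_iff₀ (by linarith), h1]
  nlinarith

theorem eventually_truncNum_lt {d μ γ : ℝ} (hd : 0 < d) (hμ : 0 < μ) (hγ : μ ≤ γ) :
    ∀ᶠ n : ℝ in Filter.atTop, (truncNum d μ γ n : ℝ) < n := by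
  have hX : Filter.Tendsto (fun n : ℝ => d * n / μ) Filter.atTop Filter.atTop :=
    (Filter.tendsto_id.const_mul_atTop hd).atTop_div_const hμ
  filter_upwards [(tendsto_arsinh_atTop.comp hX).eventually eventually_sinh_div_le_sinh_sub_one,
    eventually_mul_le_sinh (d / μ), Filter.eventually_ge_atTop 1] with n h1 h2 hn
  have hn0 : 0 < n := by linarith
  simp only [Function.comp_apply, sinh_arsinh] at h1
  have hX0 : 0 < d * n / μ := by positivity
  have hY0 : 0 < arsinh (d * n / μ) := arsinh_pos_iff.2 hX0
  have h3 : arsinh (d * n / μ) ≤ n := by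
    rw [← sinh_le_sinh, sinh_arsinh]; convert h2 using 1; ring
  have hm : 0 < mesh d μ n := div_pos hY0 hn0
  have hq : 0 < q (d * n / μ) := div_pos hX0 hY0
  -- The right side equals (n - 1) times the mesh size; the spare mesh step pays for the ceiling.
  have h4 : arsinh (μ / γ * q (d * n / μ)) ≤ arsinh (d * n / μ) - mesh d μ n := by
    have : mesh d μ n ≤ 1 := (div_le_one hn0).2 h3
    calc _ ≤ arsinh (q (d * n / μ)) := by
          rw [arsinh_le_arsinh]
          have : μ / γ ≤ 1 := (div_le_one (by linarith)).2 hγ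
          nlinarith
      _ ≤ arsinh (d * n / μ) - 1 := by
          rw [← sinh_le_sinh, sinh_arsinh]; exact h1
      _ ≤ _ := by linarith
  have h5 : 1 / mesh d μ n * arsinh (μ / γ * q (d * n / μ)) ≤ n - 1 := by
    rw [div_mul_eq_mul_div, one_mul, div_le_iff₀ hm]
    refine h4.trans_eq ?_
    unfold mesh; field_simp
  have h6 := Int.ceil_lt_add_one (1 / mesh d μ n * arsinh (μ / γ * q (d * n / μ)))
  unfold truncNum
  linarith

end

/-! ### Residue theorem on rectangles with simple poles on the real axis -/

section

/-- The integral of `f` over the boundary of `[a, b] × [-y, y]`, counterclockwise. -/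
def rectIntegral (f : ℂ → ℂ) (a b y : ℝ) : ℂ :=
  (∫ t in a..b, f (t - y * Complex.I)) - (∫ t in a..b, f (t + y * Complex.I)) +
    Complex.I * (∫ s in -y..y, f (b + s * Complex.I)) -
    Complex.I * ∫ s in -y..y, f (a + s * Complex.I)

/-- The boundary of the rectangle `[a, b] × [-y, y]`. -/
def rectBoundary (a b y : ℝ) : Set ℂ :=
  {z | z.re ∈ Set.Icc a b ∧ z.im ∈ Set.Icc (-y) y ∧
    (z.re = a ∨ z.re = b ∨ z.im = -y ∨ z.im = y)}

variable {a b y : ℝ} {f g : ℂ → ℂ}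

theorem sub_mem_rectBoundary (hy : 0 ≤ y) {t : ℝ} (ht : t ∈ Set.Icc a b) :
    (t : ℂ) - y * Complex.I ∈ rectBoundary a b y := by
  simp [rectBoundary, ht.1, ht.2, hy]

theorem add_mem_rectBoundary (hy : 0 ≤ y) {t : ℝ} (ht : t ∈ Set.Icc a b) :
    (t : ℂ) + y * Complex.I ∈ rectBoundary a b y := by
  simp [rectBoundary, ht.1, ht.2, hy]

theorem right_mem_rectBoundary (hab : a ≤ b) {s : ℝ} (hs : s ∈ Set.Icc (-y) y) :
    (b : ℂ) + s * Complex.I ∈ rectBoundary a b y := by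
  simp [rectBoundary, hab, hs.1, hs.2]

theorem left_mem_rectBoundary (hab : a ≤ b) {s : ℝ} (hs : s ∈ Set.Icc (-y) y) :
    (a : ℂ) + s * Complex.I ∈ rectBoundary a b y := by
  simp [rectBoundary, hab, hs.1, hs.2]

theorem rectIntegral_congr (hab : a ≤ b) (hy : 0 ≤ y) (h : Set.EqOn f g (rectBoundary a b y)) :
    rectIntegral f a b y = rectIntegral g a b y := by
  have hy' : -y ≤ y := by linarith
  unfold rectIntegral
  congr 1
  · congr 1
    · congr 1
      · refine intervalIntegral.integral_congr fun t ht => h (sub_mem_rectBoundary hy ?_)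
        rwa [Set.uIcc_of_le hab] at ht
      · refine intervalIntegral.integral_congr fun t ht => h (add_mem_rectBoundary hy ?_)
        rwa [Set.uIcc_of_le hab] at ht
    · congr 1
      refine intervalIntegral.integral_congr fun t ht => h (right_mem_rectBoundary hab ?_)
      rwa [Set.uIcc_of_le hy'] at ht
  · congr 1
    refine intervalIntegral.integral_congr fun t ht => h (left_mem_rectBoundary hab ?_)
    rwa [Set.uIcc_of_le hy'] at ht

theorem intervalIntegrable_sides (hab : a ≤ b) (hy : 0 ≤ y)
    (hf : ContinuousOn f (rectBoundary a b y)) :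
    IntervalIntegrable (fun t : ℝ => f (t - y * Complex.I)) MeasureTheory.volume a b ∧
    IntervalIntegrable (fun t : ℝ => f (t + y * Complex.I)) MeasureTheory.volume a b ∧
    IntervalIntegrable (fun s : ℝ => f (b + s * Complex.I)) MeasureTheory.volume (-y) y ∧
    IntervalIntegrable (fun s : ℝ => f (a + s * Complex.I)) MeasureTheory.volume (-y) y := by
  have hy' : -y ≤ y := by linarith
  refine ⟨?_, ?_, ?_, ?_⟩ <;> refine ContinuousOn.intervalIntegrable_of_Icc ‹_› ?_ <;>
    refine hf.comp (by fun_prop) fun t ht => ?_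
  · exact sub_mem_rectBoundary hy ht
  · exact add_mem_rectBoundary hy ht
  · exact right_mem_rectBoundary hab ht
  · exact left_mem_rectBoundary hab ht

theorem rectIntegral_add (hab : a ≤ b) (hy : 0 ≤ y) (hf : ContinuousOn f (rectBoundary a b y))
    (hg : ContinuousOn g (rectBoundary a b y)) :
    rectIntegral (fun z => f z + g z) a b y = rectIntegral f a b y + rectIntegral g a b y := by
  obtain ⟨f1, f2, f3, f4⟩ := intervalIntegrable_sides hab hy hf
  obtain ⟨g1, g2, g3, g4⟩ := intervalIntegrable_sides hab hy hg
  unfold rectIntegral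
  rw [intervalIntegral.integral_add f1 g1, intervalIntegral.integral_add f2 g2,
    intervalIntegral.integral_add f3 g3, intervalIntegral.integral_add f4 g4]
  ring

theorem rectIntegral_const_mul (c : ℂ) :
    rectIntegral (fun z => c * f z) a b y = c * rectIntegral f a b y := by
  unfold rectIntegral
  simp only [intervalIntegral.integral_const_mul]
  ring

theorem rectIntegral_sum {ι : Type*} (s : Finset ι) (F : ι → ℂ → ℂ) (hab : a ≤ b) (hy : 0 ≤ y)
    (hF : ∀ i ∈ s, ContinuousOn (F i) (rectBoundary a b y)) :
    rectIntegral (fun z => ∑ i ∈ s, F i z) a b y = ∑ i ∈ s, rectIntegral (F i) a b y := by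
  classical
  induction s using Finset.induction_on with
  | empty => simp [rectIntegral]
  | insert i s hi ih =>
    simp only [Finset.sum_insert hi]
    rw [rectIntegral_add hab hy (hF i (by simp))
      (continuousOn_finsetSum _ fun j hj => hF j (by simp [hj])),
      ih fun j hj => hF j (by simp [hj])]

theorem rectIntegral_eq_zero (hab : a ≤ b) (hy : 0 ≤ y)
    (hf : ∀ z : ℂ, z.re ∈ Set.Icc a b → z.im ∈ Set.Icc (-y) y → DifferentiableAt ℂ f z) :
    rectIntegral f a b y = 0 := by
  have hy' : -y ≤ y := by linarith
  have := Complex.integral_boundary_rect_eq_zero_of_differentiableOn f ⟨a, -y⟩ ⟨b, y⟩ (by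
    rintro z ⟨h1, h2⟩
    simp only [Set.uIcc_of_le hab, Set.uIcc_of_le hy', Set.mem_preimage] at h1 h2
    exact (hf z h1 h2).differentiableWithinAt)
  simp only [smul_eq_mul, Complex.ofReal_neg, neg_mul, ← sub_eq_add_neg] at this
  exact this

/-- The principal logarithm is a primitive on every side but the left one, which crosses the cut.
There log(p - z) is used instead, and the two corner corrections of πi add up to 2πi. -/
theorem rectIntegral_inv_sub {p : ℝ} (hap : a < p) (hpb : p < b) (hy : 0 < y) :
    rectIntegral (fun z => (z - p)⁻¹) a b y = 2 * π * Complex.I := by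
  have hlog : ∀ (c v : ℂ) (s t : ℝ), v ≠ 0 →
      (∀ r ∈ Set.uIcc s t, (r : ℂ) * v + c ∈ Complex.slitPlane) →
      v * ∫ r in s..t, ((r : ℂ) * v + c)⁻¹ = Complex.log (t * v + c) - Complex.log (s * v + c) := by
    intro c v s t hv hr
    have hne : ∀ r ∈ Set.uIcc s t, (r : ℂ) * v + c ≠ 0 := fun r h =>
      Complex.slitPlane_ne_zero (hr r h)
    rw [← intervalIntegral.integral_const_mul]
    refine intervalIntegral.integral_eq_sub_of_hasDerivAt
      (f := fun r : ℝ => Complex.log (r * v + c)) (fun r h => ?_) ?_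
    · have h1 : HasDerivAt (fun r : ℝ => (r : ℂ) * v + c) v r := by
        simpa using ((Complex.ofRealCLM.hasDerivAt (x := r)).mul_const v).add_const c
      simpa [div_eq_mul_inv] using h1.clog_real (hr r h)
    · refine ContinuousOn.intervalIntegrable ?_
      exact continuousOn_const.mul (ContinuousOn.inv₀ (by fun_prop) hne)
  have h1 := hlog (-p - y * Complex.I) 1 a b one_ne_zero fun r _ => by
    rw [Complex.mem_slitPlane_iff]; right; simp [hy.ne']
  have h2 := hlog (-p + y * Complex.I) 1 a b one_ne_zero fun r _ => by
    rw [Complex.mem_slitPlane_iff]; right; simp [hy.ne']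
  have h3 := hlog (b - p) Complex.I (-y) y Complex.I_ne_zero fun r _ => by
    rw [Complex.mem_slitPlane_iff]; left; simp [hpb]
  have h4 := hlog (p - a) (-Complex.I) (-y) y (neg_ne_zero.2 Complex.I_ne_zero) fun r _ => by
    rw [Complex.mem_slitPlane_iff]; left; simp [hap]
  have e4 : ∫ s in -y..y, ((a : ℂ) + s * Complex.I - p)⁻¹ =
      -∫ s in -y..y, ((s : ℂ) * -Complex.I + (p - a))⁻¹ := by
    rw [← intervalIntegral.integral_neg]
    congr 1; ext s; rw [← inv_neg]; congr 1; ring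
  have e1 : ∫ t in a..b, ((t : ℂ) - y * Complex.I - p)⁻¹ =
      ∫ t in a..b, ((t : ℂ) * 1 + (-p - y * Complex.I))⁻¹ := by
    congr 1; ext s; congr 1; ring
  have e2 : ∫ t in a..b, ((t : ℂ) + y * Complex.I - p)⁻¹ =
      ∫ t in a..b, ((t : ℂ) * 1 + (-p + y * Complex.I))⁻¹ := by
    congr 1; ext s; congr 1; ring
  have e3 : ∫ s in -y..y, ((b : ℂ) + s * Complex.I - p)⁻¹ =
      ∫ s in -y..y, ((s : ℂ) * Complex.I + (b - p))⁻¹ := by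
    congr 1; ext s; congr 1; ring
  rw [one_mul] at h1 h2
  rw [neg_mul] at h4
  have l1 : Complex.log (a * 1 + (-p + y * Complex.I)) =
      Complex.log (y * -Complex.I + (p - a)) + π * Complex.I := by
    have h := Complex.arg_neg_eq_arg_sub_pi_of_im_pos
      (x := (a : ℂ) * 1 + (-p + y * Complex.I)) (by simpa using hy)
    have e : (y : ℂ) * -Complex.I + (p - a) = -((a : ℂ) * 1 + (-p + y * Complex.I)) := by ring
    rw [e, Complex.log, Complex.log, norm_neg, h]
    push_cast; ring
  have l2 : Complex.log (a * 1 + (-p - y * Complex.I)) =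
      Complex.log ((-y : ℝ) * -Complex.I + (p - a)) - π * Complex.I := by
    have h := Complex.arg_neg_eq_arg_add_pi_of_im_neg
      (x := (a : ℂ) * 1 + (-p - y * Complex.I)) (by simpa using hy)
    have e : ((-y : ℝ) : ℂ) * -Complex.I + (p - a) = -((a : ℂ) * 1 + (-p - y * Complex.I)) := by
      push_cast; ring
    rw [e, Complex.log, Complex.log, norm_neg, h]
    push_cast; ring
  have l3 : (b : ℂ) * 1 + (-p + y * Complex.I) = y * Complex.I + (b - p) := by ring
  have l4 : (b : ℂ) * 1 + (-p - y * Complex.I) = (-y : ℝ) * Complex.I + (b - p) := by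
    push_cast; ring
  unfold rectIntegral
  rw [e1, e2, e3, e4, h1, h2, h3, l1, l2, l3, l4]
  linear_combination -h4

theorem analyticAt_dslope_self {f : ℂ → ℂ} {p : ℂ} (hf : AnalyticAt ℂ f p) :
    AnalyticAt ℂ (dslope f p) p := by
  obtain ⟨q, hq⟩ := hf
  exact ⟨_, hq.has_fpower_series_dslope_fslope⟩

/-- Near a simple zero of `D`, the quotient `F / D` is its principal part plus an analytic
function. -/
theorem exists_analyticAt_eq_div_sub {F D : ℂ → ℂ} {p : ℂ} (hF : AnalyticAt ℂ F p)
    (hD : AnalyticAt ℂ D p) (hp : D p = 0) (hp' : deriv D p ≠ 0) :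
    ∃ φ : ℂ → ℂ, AnalyticAt ℂ φ p ∧
      ∀ z ≠ p, F z / D z - F p / deriv D p * (z - p)⁻¹ = φ z := by
  -- With D(z) = (z - p) D₁(z), the quotient is H(z)/(z - p) for H = F/D₁, so φ is the difference
  -- quotient of H at p.
  have h1 : AnalyticAt ℂ (fun z => F z / dslope D p z) p :=
    hF.div (analyticAt_dslope_self hD) (by rwa [dslope_same])
  refine ⟨_, analyticAt_dslope_self h1, fun z hz => ?_⟩
  have hz' : z - p ≠ 0 := sub_ne_zero.2 hz
  rw [dslope_of_ne _ hz, slope_def_field, dslope_same, dslope_of_ne _ hz, slope_def_field, hp]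
  -- Other zeros of D are harmless: by the convention x/0 = 0 both sides agree there too.
  rcases eq_or_ne (D z) 0 with h | h
  · simp [h]; field_simp
  · field_simp
    ring

/-- The residue theorem for a quotient `F / D` on a rectangle, with simple zeros of the
denominator on the real axis. -/
theorem rectIntegral_div {F D : ℂ → ℂ} (P : Finset ℝ) (hy : 0 < y) (hab : a < b)
    (hF : ∀ z : ℂ, z.re ∈ Set.Icc a b → z.im ∈ Set.Icc (-y) y → AnalyticAt ℂ F z)
    (hD : ∀ z : ℂ, z.re ∈ Set.Icc a b → z.im ∈ Set.Icc (-y) y → AnalyticAt ℂ D z)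
    (hP : ∀ p ∈ P, p ∈ Set.Ioo a b ∧ D p = 0 ∧ deriv D p ≠ 0)
    (hD0 : ∀ z : ℂ, z.re ∈ Set.Icc a b → z.im ∈ Set.Icc (-y) y → D z = 0 →
      ∃ p ∈ P, z = (p : ℝ)) :
    rectIntegral (fun z => F z / D z) a b y =
      2 * π * Complex.I * ∑ p ∈ P, F p / deriv D p := by
  classical
  have hne : ∀ z ∈ rectBoundary a b y, ∀ p ∈ P, z ≠ (p : ℂ) := by
    rintro z ⟨-, -, h⟩ p hp rfl
    obtain ⟨⟨h1, h2⟩, -⟩ := hP p hp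
    simp only [Complex.ofReal_re, Complex.ofReal_im] at h
    rcases h with h | h | h | h <;> linarith
  have hcont1 : ContinuousOn (fun z => F z / D z) (rectBoundary a b y) := fun z hz => by
    have : D z ≠ 0 := fun h => by
      obtain ⟨p, hp, h'⟩ := hD0 z hz.1 hz.2.1 h
      exact hne z hz p hp h'
    exact ((hF z hz.1 hz.2.1).div (hD z hz.1 hz.2.1) this).continuousAt.continuousWithinAt
  have hcont2 : ∀ p ∈ P, ContinuousOn (fun z : ℂ => F p / deriv D p * (z - p)⁻¹)
      (rectBoundary a b y) := fun p hp => by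
    refine continuousOn_const.mul (ContinuousOn.inv₀ (by fun_prop) fun z hz => ?_)
    exact sub_ne_zero.2 (hne z hz p hp)
  choose! φ hφ hφ' using fun (p : ℝ) (hp : p ∈ P) =>
    exists_analyticAt_eq_div_sub
      (hF p (by simpa using Set.Ioo_subset_Icc_self (hP p hp).1) (by simp [hy.le]))
      (hD p (by simpa using Set.Ioo_subset_Icc_self (hP p hp).1) (by simp [hy.le]))
      (hP p hp).2.1 (hP p hp).2.2
  -- F/D minus all its principal parts, with the removable singularities filled in by φ; Cauchy's
  -- theorem applies to it.
  set G : ℂ → ℂ := fun z =>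
    if z.re ∈ P ∧ z.im = 0 then
      φ z.re z - ∑ p ∈ P.erase z.re, F p / deriv D p * (z - p)⁻¹
    else F z / D z - ∑ p ∈ P, F p / deriv D p * (z - p)⁻¹ with hG
  have hGne : ∀ z : ℂ, (∀ p ∈ P, z ≠ (p : ℂ)) →
      G z = F z / D z - ∑ p ∈ P, F p / deriv D p * (z - p)⁻¹ := by
    intro z hz
    simp only [hG]
    rw [if_neg]
    rintro ⟨h1, h2⟩
    exact hz _ h1 (Complex.ext (by simp) (by simp [h2]))
  have hGp : ∀ p ∈ P, ∀ᶠ z in nhds (p : ℂ),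
      G z = φ p z - ∑ q ∈ P.erase p, F q / deriv D q * (z - q)⁻¹ := by
    intro p hp
    have hopen : ∀ᶠ z in nhds (p : ℂ), ∀ q ∈ P.erase p, z ≠ (q : ℂ) := by
      rw [Filter.eventually_all_finset]
      intro q hq
      exact isOpen_ne.mem_nhds (by simpa using (Finset.ne_of_mem_erase hq).symm)
    filter_upwards [hopen] with z hz
    rcases eq_or_ne z p with rfl | hzp
    · simp [hG, hp]
    · rw [hGne z fun q hq => ?_, ← hφ' p hp z hzp, ← Finset.add_sum_erase _ _ hp]
      · ring
      · rcases eq_or_ne q p with rfl | h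
        · exact hzp
        · exact hz q (Finset.mem_erase.2 ⟨h, hq⟩)
  have hGint : rectIntegral G a b y = 0 := by
    refine rectIntegral_eq_zero hab.le hy.le fun z h1 h2 => ?_
    by_cases hz : ∃ p ∈ P, z = (p : ℝ)
    · obtain ⟨p, hp, rfl⟩ := hz
      refine DifferentiableAt.congr_of_eventuallyEq ?_ (hGp p hp)
      refine (hφ p hp).differentiableAt.sub (DifferentiableAt.fun_sum fun q hq => ?_)
      refine DifferentiableAt.const_mul (DifferentiableAt.inv (by fun_prop) ?_) _
      rw [sub_ne_zero]
      simpa using (Finset.ne_of_mem_erase hq).symm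
    · push Not at hz
      have hopen : ∀ᶠ w in nhds z, ∀ q ∈ P, w ≠ (q : ℂ) := by
        rw [Filter.eventually_all_finset]
        intro q hq
        exact isOpen_ne.mem_nhds (hz q hq)
      have hev : G =ᶠ[nhds z] fun z => F z / D z - ∑ p ∈ P, F p / deriv D p * (z - p)⁻¹ :=
        hopen.mono fun w hw => hGne w hw
      refine DifferentiableAt.congr_of_eventuallyEq ?_ hev
      have hDz : D z ≠ 0 := fun h => by
        obtain ⟨p, hp, h'⟩ := hD0 z h1 h2 h
        exact hz p hp h'
      refine ((hF z h1 h2).div (hD z h1 h2) hDz).differentiableAt.sub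
        (DifferentiableAt.fun_sum fun q hq => ?_)
      refine DifferentiableAt.const_mul (DifferentiableAt.inv (by fun_prop) ?_) _
      exact sub_ne_zero.2 (hz q hq)
  have hsum : rectIntegral (fun z => F z / D z) a b y =
      rectIntegral G a b y +
        rectIntegral (fun z => ∑ p ∈ P, F p / deriv D p * (z - p)⁻¹) a b y := by
    rw [← rectIntegral_add hab.le hy.le]
    · refine rectIntegral_congr hab.le hy.le fun z hz => ?_
      rw [hGne z (hne z hz)]; ring
    · refine (hcont1.sub (continuousOn_finsetSum _ hcont2)).congr fun z hz => ?_
      rw [hGne z (hne z hz)]; rfl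
    · exact continuousOn_finsetSum _ hcont2
  rw [hsum, hGint, zero_add, rectIntegral_sum _ _ hab.le hy.le hcont2, Finset.mul_sum]
  refine Finset.sum_congr rfl fun p hp => ?_
  rw [rectIntegral_const_mul, rectIntegral_inv_sub (hP p hp).1.1 (hP p hp).1.2 hy]
  ring

end

/-! ### Contour representation of the cardinal series error -/

section

theorem normSq_sin_add_mul_I (u v : ℝ) :
    ‖Complex.sin (u + v * Complex.I)‖ ^ 2 = sin u ^ 2 + sinh v ^ 2 := by
  rw [Complex.sin_add_mul_I, ← Complex.ofReal_sin, ← Complex.ofReal_cos, ← Complex.ofReal_sinh,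
    ← Complex.ofReal_cosh, Complex.sq_norm, ← Complex.ofReal_mul, ← Complex.ofReal_mul,
    Complex.normSq_add_mul_I]
  have h1 := cosh_sq v
  have h2 := sin_sq_add_cos_sq u
  linear_combination sin u ^ 2 * h1 + sinh v ^ 2 * h2

theorem abs_sinh_le_norm_sin (u v : ℝ) : |sinh v| ≤ ‖Complex.sin (u + v * Complex.I)‖ := by
  refine abs_le_of_sq_le_sq ?_ (norm_nonneg _)
  rw [normSq_sin_add_mul_I]; nlinarith [sq_nonneg (sin u)]

theorem abs_sin_le_norm_sin (u v : ℝ) : |sin u| ≤ ‖Complex.sin (u + v * Complex.I)‖ := by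
  refine abs_le_of_sq_le_sq ?_ (norm_nonneg _)
  rw [normSq_sin_add_mul_I]; nlinarith [sq_nonneg (sinh v)]

/-- The function `(z - x) sin (π z / h)`, vanishing at `x` and at the points of the mesh. -/
def sincDenom (h x : ℝ) (z : ℂ) : ℂ := (z - x) * Complex.sin (π / h * z)

variable {h x : ℝ}

theorem hasDerivAt_sincDenom (z : ℂ) :
    HasDerivAt (sincDenom h x)
      (Complex.sin (π / h * z) + (z - x) * (Complex.cos (π / h * z) * (π / h))) z := by
  have h1 : HasDerivAt (fun z : ℂ => z - x) 1 z := (hasDerivAt_id z).sub_const _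
  have h2 : HasDerivAt (fun z : ℂ => (π / h : ℂ) * z) (π / h) z := by
    simpa using (hasDerivAt_id z).const_mul (π / h : ℂ)
  exact (h1.mul h2.csin).congr_deriv (by ring)

theorem analyticAt_sincDenom (z : ℂ) : AnalyticAt ℂ (sincDenom h x) z :=
  (show Differentiable ℂ (sincDenom h x) from
    fun w => (hasDerivAt_sincDenom w).differentiableAt).analyticAt z

theorem sin_mesh (hh : 0 < h) (k : ℤ) : Complex.sin (π / h * (k * h : ℝ)) = 0 := by
  have : (h : ℂ) ≠ 0 := by exact_mod_cast hh.ne'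
  rw [Complex.sin_eq_zero_iff]
  exact ⟨k, by push_cast; field_simp⟩

theorem sin_eq_zero_mesh (hh : 0 < h) {z : ℂ} (hz : Complex.sin (π / h * z) = 0) :
    ∃ k : ℤ, z = (k * h : ℝ) := by
  have h1 : (h : ℂ) ≠ 0 := by exact_mod_cast hh.ne'
  have h2 : (π : ℂ) ≠ 0 := by exact_mod_cast pi_ne_zero
  rw [Complex.sin_eq_zero_iff] at hz
  obtain ⟨k, hk⟩ := hz
  refine ⟨k, ?_⟩
  push_cast
  field_simp at hk
  rw [hk, mul_comm]

theorem cos_mesh_mul_self (hh : 0 < h) (k : ℤ) :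
    Complex.cos (π / h * (k * h : ℝ)) * Complex.cos (π / h * (k * h : ℝ)) = 1 := by
  have := Complex.sin_sq_add_cos_sq (π / h * (k * h : ℝ))
  rw [sin_mesh hh] at this
  linear_combination this

theorem nsinc_eq (hh : 0 < h) {k : ℤ} (hx : x ≠ k * h) :
    ((nsinc ((x - k * h) / h) : ℝ) : ℂ) = Complex.sin (π / h * x) *
      Complex.cos (π / h * (k * h : ℝ)) / (π / h * (x - (k * h : ℝ))) := by
  have h1 : (h : ℂ) ≠ 0 := by exact_mod_cast hh.ne'
  have h2 : π * ((x - k * h) / h) ≠ 0 :=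
    mul_ne_zero pi_ne_zero (div_ne_zero (sub_ne_zero.2 hx) hh.ne')
  have e : ((π * ((x - k * h) / h) : ℝ) : ℂ) = π / h * x - π / h * (k * h : ℝ) := by
    push_cast; ring
  rw [nsinc, sinc_of_ne_zero h2, Complex.ofReal_div, Complex.ofReal_sin, e, Complex.sin_sub,
    sin_mesh hh]
  congr 1 <;> ring

/-- The contour integral representation of the error of a truncated cardinal series. -/
theorem sin_mul_rectIntegral {F : ℂ → ℂ} {y : ℝ} (hh : 0 < h) (hy : 0 < y)
    (hF : ∀ z : ℂ, |z.im| ≤ y → AnalyticAt ℂ F z) (hx : ∀ k : ℤ, x ≠ k * h) {K : ℕ}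
    (hK : |x| < (K + 1 / 2) * h) :
    Complex.sin (π / h * x) * rectIntegral (fun z => F z / sincDenom h x z)
      (-((K + 1 / 2) * h)) ((K + 1 / 2) * h) y =
    2 * π * Complex.I * (F x - ∑ k ∈ Finset.Icc (-K : ℤ) K, sincTerm F h x k) := by
  classical
  have h1 : (h : ℂ) ≠ 0 := by exact_mod_cast hh.ne'
  have h2 : (π : ℂ) ≠ 0 := by exact_mod_cast pi_ne_zero
  have hsin : Complex.sin (π / h * x) ≠ 0 := fun h0 => by
    obtain ⟨k, hk⟩ := sin_eq_zero_mesh hh h0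
    exact hx k (by exact_mod_cast hk)
  have hxk : ∀ k : ℤ, (x : ℂ) - (k * h : ℝ) ≠ 0 := fun k => by
    rw [← Complex.ofReal_sub]; exact_mod_cast sub_ne_zero.2 (hx k)
  set T := (K + 1 / 2) * h with hT
  have hT0 : 0 < T := by positivity
  set P : Finset ℝ := insert x ((Finset.Icc (-K : ℤ) K).image fun k : ℤ => (k : ℝ) * h) with hP
  have hxP : x ∉ (Finset.Icc (-K : ℤ) K).image fun k : ℤ => (k : ℝ) * h := by
    simp only [Finset.mem_image, not_exists, not_and]
    exact fun k _ hk => hx k hk.symm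
  have hinj : Set.InjOn (fun k : ℤ => (k : ℝ) * h) (Finset.Icc (-K : ℤ) K) := fun k _ l _ hkl => by
    exact_mod_cast mul_right_cancel₀ hh.ne' hkl
  have hdx : deriv (sincDenom h x) x = Complex.sin (π / h * x) := by
    rw [(hasDerivAt_sincDenom _).deriv]; ring
  have hdk : ∀ k : ℤ, deriv (sincDenom h x) (k * h : ℝ) =
      ((k * h : ℝ) - x) * (Complex.cos (π / h * (k * h : ℝ)) * (π / h)) := fun k => by
    rw [(hasDerivAt_sincDenom _).deriv, sin_mesh hh, zero_add]
  have hcos : ∀ k : ℤ, Complex.cos (π / h * (k * h : ℝ)) ≠ 0 := fun k h0 => by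
    have := cos_mesh_mul_self hh k
    rw [h0] at this; simp at this
  have key := rectIntegral_div (F := F) (D := sincDenom h x) P hy (by linarith : -T < T)
    (fun z _ hz => hF z (abs_le.2 hz)) (fun z _ _ => analyticAt_sincDenom z) ?_ ?_
  · rw [key, hP, Finset.sum_insert hxP, Finset.sum_image hinj, hdx]
    rw [mul_left_comm, mul_add, mul_div_cancel₀ _ hsin, Finset.mul_sum, sub_eq_add_neg,
      ← Finset.sum_neg_distrib]
    congr 2
    refine Finset.sum_congr rfl fun k _ => ?_
    rw [hdk, sincTerm, nsinc_eq hh (hx k)]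
    have e1 := hcos k
    have e2 := hxk k
    have e3 : ((k * h : ℝ) : ℂ) - x ≠ 0 := by rw [← neg_sub]; exact neg_ne_zero.2 e2
    -- The residue carries 1/cos and the sinc carries cos; at a mesh point the cosine is its own
    -- inverse.
    have e4 := cos_mesh_mul_self hh k
    set c := Complex.cos (π / h * (k * h : ℝ))
    set w : ℂ := ((k * h : ℝ) : ℂ)
    set r := Complex.sin (π / h * x)
    have e5 : (x : ℂ) - w = -(w - x) := by ring
    rw [e5]
    field_simp
    linear_combination -F w * e4
  · intro p hp
    rcases Finset.mem_insert.1 hp with rfl | hp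
    · refine ⟨abs_lt.1 hK, by simp [sincDenom], by rwa [hdx]⟩
    · obtain ⟨k, hk, rfl⟩ := Finset.mem_image.1 hp
      rw [Finset.mem_Icc] at hk
      have k1 : (-K : ℝ) ≤ k := by exact_mod_cast hk.1
      have k2 : (k : ℝ) ≤ K := by exact_mod_cast hk.2
      refine ⟨⟨by rw [hT]; nlinarith, by rw [hT]; nlinarith⟩, ?_, ?_⟩
      · rw [sincDenom, sin_mesh hh, mul_zero]
      · rw [hdk]
        refine mul_ne_zero ?_ (mul_ne_zero (hcos k) (div_ne_zero h2 h1))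
        rw [← neg_sub]; exact neg_ne_zero.2 (hxk k)
  · intro z hz _ h0
    rcases mul_eq_zero.1 h0 with h0 | h0
    · exact ⟨x, by simp [hP], sub_eq_zero.1 h0⟩
    · obtain ⟨k, rfl⟩ := sin_eq_zero_mesh hh h0
      refine ⟨k * h, Finset.mem_insert_of_mem (Finset.mem_image_of_mem _ ?_), rfl⟩
      rw [Complex.ofReal_re, hT] at hz
      have k1 : -((K : ℝ) + 1) < k := by nlinarith [hz.1]
      have k2 : (k : ℝ) < K + 1 := by nlinarith [hz.2]
      have k1' : -((K : ℤ) + 1) < k := by exact_mod_cast k1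
      have k2' : k < (K : ℤ) + 1 := by exact_mod_cast k2
      rw [Finset.mem_Icc]; omega

theorem le_norm_sincDenom_horizontal (hh : 0 < h) {v : ℝ} (hv : 0 < v) (t : ℝ) :
    v * sinh (π * v / h) ≤ ‖sincDenom h x (t + v * Complex.I)‖ ∧
    v * sinh (π * v / h) ≤ ‖sincDenom h x (t - v * Complex.I)‖ := by
  have hs : 0 ≤ sinh (π * v / h) := sinh_nonneg_iff.2 (by positivity)
  unfold sincDenom
  rw [norm_mul, norm_mul]
  constructor
  · gcongr
    · have := Complex.abs_im_le_norm ((t : ℂ) + v * Complex.I - x)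
      simpa [abs_of_pos hv] using this
    · have := abs_sinh_le_norm_sin (π / h * t) (π * v / h)
      rw [abs_of_nonneg hs] at this
      rwa [show ((π / h * t : ℝ) : ℂ) + ((π * v / h : ℝ) : ℂ) * Complex.I = π / h * (t + v * Complex.I) by
        push_cast; ring] at this
  · gcongr
    · have := Complex.abs_im_le_norm ((t : ℂ) - v * Complex.I - x)
      simpa [abs_of_pos hv] using this
    · have := abs_sinh_le_norm_sin (π / h * t) (-(π * v / h))
      rw [sinh_neg, abs_neg, abs_of_nonneg hs] at this
      rwa [show ((π / h * t : ℝ) : ℂ) + ((-(π * v / h) : ℝ) : ℂ) * Complex.I = π / h * (t - v * Complex.I) by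
        push_cast; ring] at this

theorem le_norm_sincDenom_vertical {T : ℝ} (hT : |sin (π / h * T)| = 1) (s : ℝ) :
    |T| - |x| ≤ ‖sincDenom h x (T + s * Complex.I)‖ := by
  unfold sincDenom
  rw [norm_mul]
  have h1 := Complex.abs_re_le_norm ((T : ℂ) + s * Complex.I - x)
  have h2 := abs_sin_le_norm_sin (π / h * T) (π / h * s)
  have h3 := abs_sub_abs_le_abs_sub T x
  rw [hT] at h2
  have e : (π : ℂ) / h * (T + s * Complex.I) =
      ((π / h * T : ℝ) : ℂ) + ((π / h * s : ℝ) : ℂ) * Complex.I := by push_cast; ring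
  rw [e]
  simp only [Complex.sub_re, Complex.add_re, Complex.ofReal_re, Complex.mul_re, Complex.I_re,
    Complex.ofReal_im, Complex.I_im, mul_zero, mul_one, sub_zero, add_zero] at h1
  calc |T| - |x| ≤ ‖(T : ℂ) + s * Complex.I - x‖ * 1 := by linarith
    _ ≤ _ := by gcongr

/-- Vertical sides are placed midway between mesh points, where the sine in the denominator has
modulus at least 1. -/
theorem abs_sin_half_integer (hh : 0 < h) (K : ℕ) : |sin (π / h * ((K + 1 / 2) * h))| = 1 := by
  have e : π / h * ((K + 1 / 2) * h) = π / 2 + K * π := by field_simp; ring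
  rw [e, sin_add_nat_mul_pi]
  simp

/-- The error of a truncated cardinal series, for a function that is bounded in a closed strip and
integrable along its boundary. -/
theorem norm_sub_partial_sum_le {F : ℂ → ℂ} {y C I : ℝ} {g : ℝ → ℝ} (hh : 0 < h) (hy : 0 < y)
    (hF : ∀ z : ℂ, |z.im| ≤ y → AnalyticAt ℂ F z) (hC : ∀ z : ℂ, |z.im| ≤ y → ‖F z‖ ≤ C)
    (hg : Continuous g) (hI : ∀ T : ℝ, 0 ≤ T → ∫ t in -T..T, g t ≤ I)
    (hFg : ∀ t : ℝ, ‖F (t + y * Complex.I)‖ ≤ g t ∧ ‖F (t - y * Complex.I)‖ ≤ g t)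
    (hx : ∀ k : ℤ, x ≠ k * h) {K : ℕ} (hK : |x| < (K + 1 / 2) * h) :
    ‖F x - ∑ k ∈ Finset.Icc (-K : ℤ) K, sincTerm F h x k‖ ≤
      I / (π * y * sinh (π * y / h)) + 2 * y * C / (π * ((K + 1 / 2) * h - |x|)) := by
  have hrep := sin_mul_rectIntegral hh hy hF hx hK
  have hsin1 := abs_sin_half_integer hh K
  set T := (K + 1 / 2) * h with hT
  have hT0 : 0 < T := by positivity
  have hs : 0 < sinh (π * y / h) := sinh_pos_iff.2 (by positivity)
  have hden : 0 < T - |x| := by linarith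
  have hhor : ∀ f : ℝ → ℂ, (∀ t, ‖f t‖ ≤ g t / (y * sinh (π * y / h))) →
      ‖∫ t in -T..T, f t‖ ≤ I / (y * sinh (π * y / h)) := fun f hf => by
    refine (intervalIntegral.norm_integral_le_of_norm_le (by linarith)
      (Filter.Eventually.of_forall fun t _ => hf t)
      ((hg.div_const _).intervalIntegrable _ _)).trans ?_
    rw [intervalIntegral.integral_div]
    gcongr
    exact hI T hT0.le
  have hver : ∀ f : ℝ → ℂ, (∀ s, |s| ≤ y → ‖f s‖ ≤ C / (T - |x|)) →
      ‖∫ s in -y..y, f s‖ ≤ C / (T - |x|) * (2 * y) := fun f hf => by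
    have := intervalIntegral.norm_integral_le_of_norm_le_const (a := -y) (b := y) (f := f)
      (C := C / (T - |x|)) fun s hs => hf s (by
        rw [Set.uIoc_of_le (by linarith)] at hs
        exact abs_le.2 ⟨hs.1.le, hs.2⟩)
    rwa [show y - -y = 2 * y by ring, abs_of_pos (show 0 < 2 * y by positivity)] at this
  have hrect : ‖rectIntegral (fun z => F z / sincDenom h x z) (-T) T y‖ ≤
      2 * (I / (y * sinh (π * y / h))) + 2 * (C / (T - |x|) * (2 * y)) := by
    unfold rectIntegral
    have i1 := hhor (fun t => F (t - y * Complex.I) / sincDenom h x (t - y * Complex.I))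
      fun t => by
        rw [norm_div]
        exact div_le_div₀ ((norm_nonneg _).trans (hFg t).2) (hFg t).2 (by positivity)
          (le_norm_sincDenom_horizontal hh hy t).2
    have i2 := hhor (fun t => F (t + y * Complex.I) / sincDenom h x (t + y * Complex.I))
      fun t => by
        rw [norm_div]
        exact div_le_div₀ ((norm_nonneg _).trans (hFg t).1) (hFg t).1 (by positivity)
          (le_norm_sincDenom_horizontal hh hy t).1
    have i3 : ∀ T', |T'| = T → |sin (π / h * T')| = 1 →
        ‖∫ s in -y..y, F ((T' : ℝ) + s * Complex.I) / sincDenom h x ((T' : ℝ) + s * Complex.I)‖ ≤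
          C / (T - |x|) * (2 * y) := fun T' h1 h2 => hver _ fun s hs => by
        have hFC := hC ((T' : ℝ) + s * Complex.I) (by simpa using hs)
        rw [norm_div]
        refine div_le_div₀ ((norm_nonneg _).trans hFC) hFC hden ?_
        rw [← h1]
        exact le_norm_sincDenom_vertical h2 s
    have i4 := i3 T (abs_of_pos hT0) hsin1
    have i5 := i3 (-T) (by rw [abs_neg, abs_of_pos hT0]) (by
      rw [mul_neg, sin_neg, abs_neg]; exact hsin1)
    refine (norm_sub_le _ _).trans ?_
    refine (add_le_add ((norm_add_le _ _).trans (add_le_add (norm_sub_le _ _) le_rfl))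
      le_rfl).trans ?_
    rw [norm_mul, norm_mul, Complex.norm_I, one_mul, one_mul]
    linarith
  have hsx : ‖Complex.sin (π / h * x)‖ ≤ 1 := by
    have : Complex.sin (π / h * x) = ((sin (π / h * x) : ℝ) : ℂ) := by push_cast; rfl
    rw [this, Complex.norm_real]
    exact abs_sin_le_one _
  have hnorm := congrArg norm hrep
  rw [norm_mul, norm_mul] at hnorm
  have h2pi : ‖(2 * π * Complex.I : ℂ)‖ = 2 * π := by
    simp [abs_of_pos pi_pos]
  rw [h2pi] at hnorm
  have hle := hnorm.symm.le.trans
    (mul_le_mul hsx hrect (norm_nonneg _) zero_le_one)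
  rw [one_mul] at hle
  have e : I / (π * y * sinh (π * y / h)) + 2 * y * C / (π * (T - |x|)) =
      (2 * (I / (y * sinh (π * y / h))) + 2 * (C / (T - |x|) * (2 * y))) / (2 * π) := by
    have := pi_pos.ne'
    field_simp
  rw [e, le_div_iff₀ (by positivity), mul_comm]
  exact hle

/-- A cardinal series reproduces the values at the points of the mesh. -/
theorem tsum_sincTerm_mesh (F : ℂ → ℂ) (hh : 0 < h) (k : ℤ) :
    ∑' l : ℤ, sincTerm F h (k * h) l = F ((k * h : ℝ) : ℂ) := by
  rw [tsum_eq_single k]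
  · simp [sincTerm, nsinc]
  · intro l hl
    have hkl : ((k - l : ℤ) : ℝ) ≠ 0 := by exact_mod_cast sub_ne_zero.2 hl.symm
    have e : π * ((k * h - l * h) / h) = ((k - l : ℤ) : ℝ) * π := by
      push_cast; field_simp
    rw [sincTerm, nsinc, e, sinc_of_ne_zero (mul_ne_zero hkl pi_ne_zero), sin_int_mul_pi]
    simp

/-- Letting K grow removes the vertical sides. At a mesh point the poles would collide, but there
the series reproduces F exactly. -/
theorem discErr_le {F : ℂ → ℂ} {y C I : ℝ} {g : ℝ → ℝ} (hh : 0 < h) (hy : 0 < y)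
    (hF : ∀ z : ℂ, |z.im| ≤ y → AnalyticAt ℂ F z) (hC : ∀ z : ℂ, |z.im| ≤ y → ‖F z‖ ≤ C)
    (hg : Continuous g) (hI : ∀ T : ℝ, 0 ≤ T → ∫ t in -T..T, g t ≤ I)
    (hFg : ∀ t : ℝ, ‖F (t + y * Complex.I)‖ ≤ g t ∧ ‖F (t - y * Complex.I)‖ ≤ g t)
    (hsum : Summable (fun k : ℤ => sincTerm F h x k)) :
    discErr F h x ≤ I / (π * y * sinh (π * y / h)) := by
  have hs : 0 < sinh (π * y / h) := sinh_pos_iff.2 (by positivity)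
  by_cases hx : ∀ k : ℤ, x ≠ k * h
  · have hlin : Filter.Tendsto (fun K : ℕ => ((K : ℝ) + 1 / 2) * h - |x|) Filter.atTop
        Filter.atTop :=
      Filter.tendsto_atTop_add_const_right _ _
        ((Filter.tendsto_atTop_add_const_right _ _ tendsto_natCast_atTop_atTop).atTop_mul_const hh)
    have hR : Filter.Tendsto (fun K : ℕ => I / (π * y * sinh (π * y / h)) +
        2 * y * C / (π * (((K : ℝ) + 1 / 2) * h - |x|))) Filter.atTop
        (nhds (I / (π * y * sinh (π * y / h)) + 0)) :=
      tendsto_const_nhds.add (tendsto_const_nhds.div_atTop (hlin.const_mul_atTop pi_pos))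
    rw [add_zero] at hR
    have hIcc : Filter.Tendsto (fun K : ℕ => Finset.Icc (-K : ℤ) K) Filter.atTop Filter.atTop := by
      refine Filter.tendsto_atTop_finset_of_monotone (fun m n hmn => ?_) fun k => ⟨k.natAbs, ?_⟩
      · exact Finset.Icc_subset_Icc (by omega) (by omega)
      · rw [Finset.mem_Icc]; omega
    have hL := (tendsto_const_nhds (x := F x)).sub (hsum.hasSum.comp hIcc) |>.norm
    refine le_of_tendsto_of_tendsto hL hR ?_
    filter_upwards [hlin.eventually_gt_atTop 0] with K hK
    exact norm_sub_partial_sum_le hh hy hF hC hg hI hFg hx (by linarith)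
  · push Not at hx
    obtain ⟨k, rfl⟩ := hx
    rw [discErr, tsum_sincTerm_mesh F hh, sub_self, norm_zero]
    have hI0 : 0 ≤ I := by simpa using hI 0 le_rfl
    positivity

end

/-! ### Error bounds for the function class -/

section

/-- The factor whose exponential is at least 1 supplies the growth; the other factor is at least 1.
-/
theorem exp_mul_abs_le_rpow {α β μ : ℝ} (hμ : 0 ≤ μ) (hα : μ ≤ α) (hβ : μ ≤ β) (s : ℝ) :
    exp (μ * |s|) ≤ (1 + exp (-s)) ^ α * (1 + exp s) ^ β := by
  have key : ∀ a t : ℝ, 0 ≤ t → μ ≤ a → exp (μ * t) ≤ (1 + exp t) ^ a := fun a t ht ha => by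
    calc exp (μ * t) = exp t ^ μ := by rw [mul_comm, exp_mul]
      _ ≤ exp t ^ a := rpow_le_rpow_of_exponent_le (one_le_exp ht) ha
      _ ≤ (1 + exp t) ^ a := by
        apply rpow_le_rpow (exp_pos _).le (by linarith) (by linarith)
  have one : ∀ a t : ℝ, μ ≤ a → 1 ≤ (1 + exp t) ^ a := fun a t ha =>
    one_le_rpow (by linarith [exp_pos t]) (by linarith)
  rcases le_total 0 s with h | h
  · rw [abs_of_nonneg h]
    nlinarith [key β s h hβ, one α (-s) hα, exp_pos (μ * s)]
  · rw [abs_of_nonpos h]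
    nlinarith [key α (-s) (by linarith) hα, one β s hβ, exp_pos (μ * -s)]

/-- Inserting a factor cosh t ≥ 1 on the half line turns the integrand into an exact derivative. -/
theorem integral_exp_neg_abs_sinh_le {c T : ℝ} (hc : 0 < c) (hT : 0 ≤ T) :
    ∫ t in -T..T, exp (-(c * |sinh t|)) ≤ 2 / c := by
  have hcont : Continuous fun t : ℝ => exp (-(c * |sinh t|)) := by fun_prop
  have hhalf : ∫ t in (0 : ℝ)..T, exp (-(c * |sinh t|)) ≤ 1 / c := by
    have h1 : ∫ t in (0 : ℝ)..T, cosh t * exp (-(c * sinh t)) =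
        -exp (-(c * sinh T)) / c - -exp (-(c * sinh 0)) / c := by
      refine intervalIntegral.integral_eq_sub_of_hasDerivAt
        (f := fun t => -exp (-(c * sinh t)) / c) (fun t _ => ?_) ?_
      · have := ((((hasDerivAt_sinh t).const_mul c).neg.exp).neg).div_const c
        refine this.congr_deriv ?_
        show -(exp (-(c * sinh t)) * -(c * cosh t)) / c = _
        field_simp
      · exact Continuous.intervalIntegrable (by fun_prop) _ _
    calc ∫ t in (0 : ℝ)..T, exp (-(c * |sinh t|))
        ≤ ∫ t in (0 : ℝ)..T, cosh t * exp (-(c * sinh t)) := by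
          refine intervalIntegral.integral_mono_on hT (hcont.intervalIntegrable _ _)
            (Continuous.intervalIntegrable (by fun_prop) _ _) fun t ht => ?_
          rw [abs_of_nonneg (sinh_nonneg_iff.2 ht.1)]
          exact le_mul_of_one_le_left (exp_pos _).le (one_le_cosh t)
      _ ≤ 1 / c := by
          rw [h1]
          have : 0 < exp (-(c * sinh T)) / c := by positivity
          simp only [sinh_zero, mul_zero, neg_zero, exp_zero, neg_div]
          linarith
  have hneg : ∫ t in -T..(0 : ℝ), exp (-(c * |sinh t|)) =
      ∫ t in (0 : ℝ)..T, exp (-(c * |sinh t|)) := by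
    have := intervalIntegral.integral_comp_neg (a := 0) (b := T)
      fun t => exp (-(c * |sinh t|))
    simp only [sinh_neg, abs_neg, neg_zero] at this
    exact this.symm
  rw [← intervalIntegral.integral_add_adjacent_intervals (hcont.intervalIntegrable (-T) 0)
    (hcont.intervalIntegrable 0 T), hneg]
  have : 2 / c = 1 / c + 1 / c := by ring
  linarith

theorem cos_pi_div_two_mul_sin_pos {y : ℝ} (hy : |y| < π / 2) : 0 < cos (π / 2 * sin y) := by
  obtain ⟨h1, h2⟩ := abs_lt.1 hy
  have h3 : sin y < 1 := by
    rw [← sin_pi_div_two]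
    exact sin_lt_sin_of_lt_of_le_pi_div_two h1.le le_rfl h2
  have h4 : -1 < sin y := by
    rw [← sin_pi_div_two, ← sin_neg]
    exact sin_lt_sin_of_lt_of_le_pi_div_two le_rfl h2.le h1
  exact cos_pos_of_mem_Ioo ⟨by nlinarith [pi_pos], by nlinarith [pi_pos]⟩

theorem cos_pi_div_two_mul_sin_le {v y : ℝ} (hvy : |v| ≤ y) (hy : y ≤ π / 2) :
    cos (π / 2 * sin y) ≤ cos (π / 2 * sin v) := by
  have e : cos (π / 2 * sin v) = cos (π / 2 * sin |v|) := by
    rcases abs_cases v with ⟨h, -⟩ | ⟨h, -⟩ <;> rw [h]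
    rw [sin_neg, mul_neg, cos_neg]
  have h1 : sin |v| ≤ sin y := sin_le_sin_of_le_of_le_pi_div_two
    (by linarith [abs_nonneg v, pi_pos]) hy hvy
  have h2 : 0 ≤ sin |v| := sin_nonneg_of_nonneg_of_le_pi (abs_nonneg v) (by linarith [pi_pos])
  rw [e]
  refine cos_le_cos_of_nonneg_of_le_pi (by positivity) ?_ (by gcongr)
  nlinarith [sin_le_one y, pi_pos]

variable {L R α β d : ℝ} {F : ℂ → ℂ}

theorem MemLDE.norm_le (hF : MemLDE L R α β d F) (hL : 0 < L) (hα : 0 < α) (hβ : 0 < β)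
    (hd : d < π / 2) {v y : ℝ} (hvy : |v| ≤ y) (hyd : y < d) (t : ℝ) :
    ‖F (t + v * Complex.I)‖ ≤ L / cos (π / 2 * sin y) ^ (α + β) *
      exp (-(π * min α β * cos y * |sinh t|)) := by
  have hy0 : 0 ≤ y := (abs_nonneg v).trans hvy
  have hvd : |v| < d := hvy.trans_lt hyd
  have hκ : 0 < cos (π / 2 * sin y) :=
    cos_pi_div_two_mul_sin_pos (by rw [abs_of_nonneg hy0]; linarith)
  have hκv := cos_pi_div_two_mul_sin_le hvy (by linarith)
  have hcos : cos y ≤ cos v := by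
    rw [← cos_abs v]
    exact cos_le_cos_of_nonneg_of_le_pi (abs_nonneg v) (by linarith [pi_pos]) hvy
  have hcos0 : 0 ≤ cos y := cos_nonneg_of_neg_pi_div_two_le_of_le (by linarith) (by linarith)
  have hb := hF.bound_strip (t + v * Complex.I) (by simpa [strip] using hvd)
  have h1 := le_norm_one_add_exp_neg_pi_sinh (y := v) (by linarith) t
  have h2 := le_norm_one_add_exp_pi_sinh (y := v) (by linarith) t
  have hμ : 0 < min α β := lt_min hα hβ
  set s := π * sinh t * cos v with hs
  set κ := cos (π / 2 * sin y)
  have h3 := exp_mul_abs_le_rpow hμ.le (min_le_left α β) (min_le_right α β) s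
  have h4 : exp (π * min α β * cos y * |sinh t|) ≤ exp (min α β * |s|) := by
    rw [exp_le_exp, hs, abs_mul, abs_mul, abs_of_pos pi_pos, abs_of_nonneg (hcos0.trans hcos)]
    calc π * min α β * cos y * |sinh t| ≤ π * min α β * cos v * |sinh t| := by gcongr
      _ = _ := by ring
  have h5 : κ ^ (α + β) * exp (π * min α β * cos y * |sinh t|) ≤
      ‖1 + Complex.exp (-(π * Complex.sinh (t + v * Complex.I)))‖ ^ α *
        ‖1 + Complex.exp (π * Complex.sinh (t + v * Complex.I))‖ ^ β := by
    have e1 := exp_pos s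
    have e2 := exp_pos (-s)
    calc κ ^ (α + β) * exp (π * min α β * cos y * |sinh t|)
        ≤ κ ^ (α + β) * ((1 + exp (-s)) ^ α * (1 + exp s) ^ β) := by
          gcongr; exact h4.trans h3
      _ = ((1 + exp (-s)) * κ) ^ α * ((1 + exp s) * κ) ^ β := by
          rw [rpow_add hκ, mul_rpow (by positivity) hκ.le, mul_rpow (by positivity) hκ.le]; ring
      _ ≤ _ := by
          gcongr
          · exact (mul_le_mul_of_nonneg_left hκv (by positivity)).trans h1
          · exact (mul_le_mul_of_nonneg_left hκv (by positivity)).trans h2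
  refine hb.trans ?_
  rw [exp_neg, ← div_eq_mul_inv, div_div]
  exact div_le_div_of_nonneg_left hL.le (mul_pos (rpow_pos_of_pos hκ _) (exp_pos _)) h5

theorem MemLDE.norm_ofReal_le (hF : MemLDE L R α β d F) (hR : 0 < R) (hα : 0 < α) (hβ : 0 < β)
    (t : ℝ) : ‖F t‖ ≤ R * exp (π * α * sinh t) ∧ ‖F t‖ ≤ R * exp (-(π * β * sinh t)) := by
  have hb := hF.bound_real t
  set s := π * sinh t with hs
  have key : ∀ a u : ℝ, 0 < a → exp (a * u) ≤ (1 + exp u) ^ a := fun a u ha => by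
    rw [mul_comm, exp_mul]
    exact rpow_le_rpow (exp_pos _).le (by linarith) ha.le
  have one : ∀ a u : ℝ, 0 < a → 1 ≤ (1 + exp u) ^ a := fun a u ha =>
    one_le_rpow (by linarith [exp_pos u]) ha.le
  have h1 := key α (-s) hα
  have h2 := key β s hβ
  have h3 := one α (-s) hα
  have h4 := one β s hβ
  constructor
  · refine hb.trans ?_
    rw [show π * α * sinh t = -(α * -s) by rw [hs]; ring, exp_neg (α * -s), ← div_eq_mul_inv]
    refine div_le_div_of_nonneg_left hR.le (exp_pos _) ?_
    nlinarith [exp_pos (α * -s)]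
  · refine hb.trans ?_
    rw [show π * β * sinh t = β * s by rw [hs]; ring, exp_neg (β * s), ← div_eq_mul_inv]
    refine div_le_div_of_nonneg_left hR.le (exp_pos _) ?_
    nlinarith [exp_pos (β * s)]

theorem MemLDE.norm_sincTerm_le (hF : MemLDE L R α β d F) (hR : 0 < R) (hα : 0 < α) (hβ : 0 < β)
    (h x : ℝ) (k : ℤ) : ‖sincTerm F h x k‖ ≤ R * exp (π * α * sinh (k * h)) ∧
      ‖sincTerm F h x k‖ ≤ R * exp (-(π * β * sinh (k * h))) := by
  have h1 : ‖sincTerm F h x k‖ ≤ ‖F ((k * h : ℝ) : ℂ)‖ := by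
    rw [sincTerm, norm_mul, Complex.norm_real]
    exact mul_le_of_le_one_right (norm_nonneg _) (abs_sinc_le_one _)
  have h2 := hF.norm_ofReal_le hR hα hβ (k * h)
  exact ⟨h1.trans h2.1, h1.trans h2.2⟩

theorem MemLDE.summable_sincTerm (hF : MemLDE L R α β d F) (hR : 0 < R) (hα : 0 < α)
    (hβ : 0 < β) {h : ℝ} (hh : 0 < h) (x : ℝ) : Summable fun k : ℤ => sincTerm F h x k :=
  summable_of_norm_le_exp_sinh hR.le (mul_pos pi_pos hα) (mul_pos pi_pos hβ) hh
    (fun k => (hF.norm_sincTerm_le hR hα hβ h x k).1)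
    (fun k => (hF.norm_sincTerm_le hR hα hβ h x k).2)

theorem MemLDE.discErr_le_sinh (hF : MemLDE L R α β d F) (hL : 0 < L) (hR : 0 < R) (hα : 0 < α)
    (hβ : 0 < β) (hd0 : 0 < d) (hd : d < π / 2) {h : ℝ} (hh : 0 < h) (x : ℝ) :
    discErr F h x ≤ L / cos (π / 2 * sin d) ^ (α + β) * (2 / (π * min α β * cos d)) /
      (π * d * sinh (π * d / h)) := by
  have hμ : 0 < min α β := lt_min hα hβ
  have hκ : 0 < cos (π / 2 * sin d) :=
    cos_pi_div_two_mul_sin_pos (by rw [abs_of_pos hd0]; exact hd)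
  have hcd : 0 < cos d := cos_pos_of_mem_Ioo ⟨by linarith, hd⟩
  have hs : 0 < sinh (π * d / h) := sinh_pos_iff.2 (by positivity)
  have hcont : ContinuousAt (fun y => L / cos (π / 2 * sin y) ^ (α + β) *
      (2 / (π * min α β * cos y)) / (π * y * sinh (π * y / h))) d := by
    have e1 : ContinuousAt (fun y => cos (π / 2 * sin y) ^ (α + β)) d :=
      ContinuousAt.rpow_const (by fun_prop) (Or.inl hκ.ne')
    refine ContinuousAt.div (ContinuousAt.mul (continuousAt_const.div e1 ?_)
      (ContinuousAt.div (by fun_prop) (by fun_prop) ?_)) (by fun_prop) ?_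
    · exact (rpow_pos_of_pos hκ _).ne'
    · positivity
    · positivity
  -- F need not extend to the boundary of the strip, so the bound is proved for each y < d and
  -- passed to the limit.
  refine ge_of_tendsto (hcont.tendsto.mono_left (nhdsWithin_le_nhds (s := Set.Iio d))) ?_
  filter_upwards [Ioo_mem_nhdsLT hd0] with y hy
  have hcy : 0 < cos y := cos_pos_of_mem_Ioo ⟨by linarith [hy.1], by linarith [hy.2]⟩
  have hκy : 0 < cos (π / 2 * sin y) :=
    cos_pi_div_two_mul_sin_pos (by rw [abs_of_pos hy.1]; linarith [hy.2])
  have hκy' := rpow_pos_of_pos hκy (α + β)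
  refine discErr_le (g := fun t => L / cos (π / 2 * sin y) ^ (α + β) *
    exp (-(π * min α β * cos y * |sinh t|))) (C := L / cos (π / 2 * sin y) ^ (α + β)) hh hy.1
    (fun z hz => hF.analytic z (hz.trans_lt hy.2)) (fun z hz => ?_) (by fun_prop)
    (fun T hT => ?_) (fun t => ⟨?_, ?_⟩) (hF.summable_sincTerm hR hα hβ hh x)
  · have := hF.norm_le hL hα hβ hd hz hy.2 z.re
    rw [Complex.re_add_im] at this
    refine this.trans (mul_le_of_le_one_right (by positivity) (exp_le_one_iff.2 ?_))
    rw [neg_nonpos]; positivity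
  · rw [intervalIntegral.integral_const_mul]
    have := integral_exp_neg_abs_sinh_le (show 0 < π * min α β * cos y by positivity) hT
    gcongr
  · exact hF.norm_le hL hα hβ hd (abs_of_pos hy.1).le hy.2 t
  · have := hF.norm_le hL hα hβ hd (v := -y) (by rw [abs_neg, abs_of_pos hy.1]) hy.2 t
    simpa [sub_eq_add_neg] using this

theorem MemLDE.discErr_le_exp (hF : MemLDE L R α β d F) (hL : 0 < L) (hR : 0 < R) (hα : 0 < α)
    (hβ : 0 < β) (hd0 : 0 < d) (hd : d < π / 2) {h : ℝ} (hh : 0 < h)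
    (hq : min α β * q (d / min α β) ≤ d / h) (x : ℝ) :
    discErr F h x ≤ 2 / (π * d) * discConst L α β d * exp (-(π * d / h)) := by
  have hμ : 0 < min α β := lt_min hα hβ
  have hκ : 0 < cos (π / 2 * sin d) :=
    cos_pi_div_two_mul_sin_pos (by rw [abs_of_pos hd0]; exact hd)
  have hκ' := rpow_pos_of_pos hκ (α + β)
  have hcd : 0 < cos d := cos_pos_of_mem_Ioo ⟨by linarith, hd⟩
  refine (hF.discErr_le_sinh hL hR hα hβ hd0 hd hh x).trans ?_
  unfold discConst
  set E := exp (-(π * d / h)) with hE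
  have hE0 : 0 < E := exp_pos _
  set μ := min α β
  have hq0 : 0 < q (d / μ) := div_pos (by positivity) (arsinh_pos_iff.2 (by positivity))
  have hX : 0 < 1 - exp (-(2 * π * μ * q (d / μ))) := by
    rw [sub_pos, exp_lt_one_iff, neg_neg_iff_pos]; positivity
  have hsinh : 2 * E * sinh (π * d / h) = 1 - E ^ 2 := by
    have : exp (π * d / h) * E = 1 := by rw [hE, ← exp_add]; simp
    rw [sinh_eq, ← hE]; linear_combination this
  -- Since 1/sinh(πd/h) = 2E/(1 - E²), a bound on E² free of h is what keeps the constant uniform.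
  have hE2 : E ^ 2 ≤ exp (-(2 * π * μ * q (d / μ))) := by
    rw [hE, ← exp_nat_mul, exp_le_exp]
    have : π * (μ * q (d / μ)) ≤ π * (d / h) := by gcongr
    push_cast
    have e : π * d / h = π * (d / h) := by ring
    rw [e]; linarith
  have hs : sinh (π * d / h) = (1 - E ^ 2) / (2 * E) := by
    rw [← hsinh]; field_simp
  have hY : 0 < 1 - E ^ 2 := by linarith
  rw [hs]
  calc _ = 4 * L * E / (π * π * μ * cos (π / 2 * sin d) ^ (α + β) * cos d * d) / (1 - E ^ 2) := by
        field_simp; ring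
    _ ≤ 4 * L * E / (π * π * μ * cos (π / 2 * sin d) ^ (α + β) * cos d * d) /
        (1 - exp (-(2 * π * μ * q (d / μ)))) := by
        gcongr
    _ = _ := by
        field_simp; ring

theorem MemLDE.truncErr_le (hF : MemLDE L R α β d F) (hR : 0 < R) (hα : 0 < α) (hβ : 0 < β)
    (hd0 : 0 < d) {h Q : ℝ} (hh : 0 < h) (hQ : d / h = Q) {M N : ℤ} (hM : 0 ≤ M) (hN : 0 ≤ N)
    (hM' : Q ≤ α * sinh (M * h)) (hN' : Q ≤ β * sinh (N * h)) (x : ℝ) :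
    truncErr F h M N x ≤ 2 / (π * d) * R * exp (-(π * Q)) := by
  have key : ∀ a s c : ℝ, 0 < a → s < c → Q ≤ a * s →
      R / (π * a * h * c) * exp (-(π * a * s)) ≤ 1 / (π * d) * R * exp (-(π * Q)) := by
    intro a s c ha hsc hQs
    -- From d = Qh, Q ≤ a s and s < c, with s and c the sinh and cosh at the cut-off: this trades
    -- the factor 1/h for 1/d.
    have h1 : d ≤ a * h * c := by
      have : d = Q * h := by rw [← hQ]; field_simp
      rw [this]
      calc Q * h ≤ a * s * h := by gcongr
        _ ≤ a * c * h := by gcongr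
        _ = _ := by ring
    have h2 : π * Q ≤ π * a * s := by rw [mul_assoc]; gcongr
    have h3 : R / (π * a * h * c) ≤ 1 / (π * d) * R := by
      rw [div_mul_eq_mul_div, one_mul]
      refine div_le_div_of_nonneg_left hR.le (by positivity) ?_
      calc π * d ≤ π * (a * h * c) := by gcongr
        _ = _ := by ring
    gcongr
  have h1 := norm_tsum_Iic_le hR.le (mul_pos pi_pos hα) hh hM
    fun k _ => (hF.norm_sincTerm_le hR hα hβ h x k).1
  have h2 := norm_tsum_Ici_le hR.le (mul_pos pi_pos hβ) hh hN
    fun k _ => (hF.norm_sincTerm_le hR hα hβ h x k).2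
  refine (norm_add_le _ _).trans ((add_le_add h1 h2).trans ?_)
  have k1 := key α _ _ hα (sinh_lt_cosh _) hM'
  have k2 := key β _ _ hβ (sinh_lt_cosh _) hN'
  have e : 2 / (π * d) * R * exp (-(π * Q)) =
    1 / (π * d) * R * exp (-(π * Q)) + 1 / (π * d) * R * exp (-(π * Q)) := by ring
  rw [e]
  exact add_le_add k1 k2

theorem totalErr_le_add (F : ℂ → ℂ) (h x : ℝ) {M N : ℤ} (hM : 0 ≤ M) (hN : 0 ≤ N)
    (hsum : Summable fun k : ℤ => sincTerm F h x k) :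
    totalErr F h M N x ≤ discErr F h x + truncErr F h M N x := by
  have hd1 : Disjoint (Set.Iic (-M - 1)) (Set.Ici (N + 1)) := by
    rw [Set.disjoint_left]
    intro k h1 h2
    simp only [Set.mem_Iic, Set.mem_Ici] at h1 h2
    omega
  have hcompl : (((Finset.Icc (-M) N : Finset ℤ) : Set ℤ))ᶜ =
      Set.Iic (-M - 1) ∪ Set.Ici (N + 1) := by
    ext k
    simp only [Finset.coe_Icc, Set.mem_compl_iff, Set.mem_Icc, Set.mem_union, Set.mem_Iic,
      Set.mem_Ici]
    omega
  have h1 := hsum.sum_add_tsum_compl (s := Finset.Icc (-M) N)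
  have h2 := (hsum.subtype (Set.Iic (-M - 1))).tsum_union_disjoint hd1
    (hsum.subtype (Set.Ici (N + 1)))
  rw [hcompl, h2] at h1
  unfold totalErr discErr truncErr
  rw [← h1]
  refine le_trans (le_of_eq ?_) (norm_add_le _ _)
  congr 1
  ring

theorem truncNum_spec {d μ γ n : ℝ} (hd : 0 < d) (hμ : 0 < μ) (hγ : 0 < γ) (hn : 0 < n) :
    0 ≤ truncNum d μ γ n ∧
      μ * q (d * n / μ) ≤ γ * sinh (truncNum d μ γ n * mesh d μ n) := by
  have hX : 0 < d * n / μ := by positivity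
  have hA : 0 < arsinh (d * n / μ) := arsinh_pos_iff.2 hX
  have hm : 0 < mesh d μ n := div_pos hA hn
  have hq : 0 < q (d * n / μ) := div_pos hX hA
  have h0 : 0 < arsinh (μ / γ * q (d * n / μ)) := arsinh_pos_iff.2 (by positivity)
  refine ⟨Int.ceil_nonneg (by positivity), ?_⟩
  have h2 : 1 / mesh d μ n * arsinh (μ / γ * q (d * n / μ)) ≤ truncNum d μ γ n := Int.le_ceil _
  rw [div_mul_eq_mul_div, one_mul, div_le_iff₀ hm, ← sinh_le_sinh, sinh_arsinh] at h2
  calc μ * q (d * n / μ) = γ * (μ / γ * q (d * n / μ)) := by field_simp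
    _ ≤ _ := by gcongr

/-- An unbounded real family has supremum 0 by convention, so boundedness is recorded to make the
supremum bound meaningful. -/
theorem ciSup_le_of_forall_le {f : ℝ → ℝ} {B : ℝ} (hf : ∀ x, f x ≤ B) :
    BddAbove (Set.range f) ∧ (⨆ x, f x) ≤ B :=
  ⟨⟨B, Set.forall_mem_range.2 hf⟩, ciSup_le hf⟩

end

end DESinc

end

theorem theorem3 (L R α β d : ℝ) (hL : 0 < L) (hR : 0 < R) (hα : 0 < α) (hβ : 0 < β)
    (hd : 0 < d) (hd' : d < Real.pi / 2) (F : ℂ → ℂ) (hF : DESinc.MemLDE L R α β d F)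
    (μ : ℝ) (hμ : μ = min α β) :
    (∀ n : ℝ, 1 ≤ n → ∀ (h : ℝ) (M N : ℤ),
      h = DESinc.mesh d μ n → M = DESinc.truncNum d μ α n → N = DESinc.truncNum d μ β n →
      -- the two exponential rates coincide
      (Real.exp (-(Real.pi * d / h)) = Real.exp (-(Real.pi * d * n / Real.arsinh (d * n / μ))) ∧
        Real.exp (-(Real.pi * μ * DESinc.q (d * n / μ))) =
          Real.exp (-(Real.pi * d * n / Real.arsinh (d * n / μ)))) ∧
      -- the cardinal series converges absolutely
      (∀ x : ℝ, Summable (fun k : ℤ => DESinc.sincTerm F h x k)) ∧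
      -- discretization error
      (BddAbove (Set.range fun x : ℝ => DESinc.discErr F h x) ∧
        (⨆ x : ℝ, DESinc.discErr F h x) ≤
          2 / (Real.pi * d) * DESinc.discConst L α β d * Real.exp (-(Real.pi * d / h))) ∧
      -- truncation error
      (BddAbove (Set.range fun x : ℝ => DESinc.truncErr F h M N x) ∧
        (⨆ x : ℝ, DESinc.truncErr F h M N x) ≤
          2 / (Real.pi * d) * R * Real.exp (-(Real.pi * μ * DESinc.q (d * n / μ)))) ∧
      -- total error
      (BddAbove (Set.range fun x : ℝ => DESinc.totalErr F h M N x) ∧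
        (⨆ x : ℝ, DESinc.totalErr F h M N x) ≤
          DESinc.totalConst L R α β d *
            Real.exp (-(Real.pi * d * n / Real.arsinh (d * n / μ))))) ∧
    -- both truncation numbers are eventually smaller than the parameter
    (∀ᶠ n : ℝ in Filter.atTop,
      (DESinc.truncNum d μ α n : ℝ) < n ∧ (DESinc.truncNum d μ β n : ℝ) < n) := by
  subst hμ
  have hμ0 : 0 < min α β := lt_min hα hβ
  refine ⟨?_, (DESinc.eventually_truncNum_lt hd hμ0 (min_le_left α β)).and
    (DESinc.eventually_truncNum_lt hd hμ0 (min_le_right α β))⟩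
  rintro n hn h M N rfl rfl rfl
  have hn0 : 0 < n := by linarith
  have hX : 0 < d * n / min α β := by positivity
  have hA : 0 < Real.arsinh (d * n / min α β) := Real.arsinh_pos_iff.2 hX
  have hm : 0 < DESinc.mesh d (min α β) n := div_pos hA hn0
  have hdm : d / DESinc.mesh d (min α β) n = min α β * DESinc.q (d * n / min α β) := by
    unfold DESinc.mesh DESinc.q
    field_simp
  have hr1 : Real.pi * d / DESinc.mesh d (min α β) n =
      Real.pi * d * n / Real.arsinh (d * n / min α β) := by
    unfold DESinc.mesh
    field_simp
  have hr2 : Real.pi * min α β * DESinc.q (d * n / min α β) =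
      Real.pi * d * n / Real.arsinh (d * n / min α β) := by
    rw [← hr1, mul_assoc, ← hdm, mul_div_assoc]
  obtain ⟨hM, hM'⟩ := DESinc.truncNum_spec hd hμ0 hα hn0
  obtain ⟨hN, hN'⟩ := DESinc.truncNum_spec hd hμ0 hβ hn0
  have hsum := fun x => hF.summable_sincTerm hR hα hβ hm x
  -- The side condition is μ q(d/μ) ≤ μ q(dn/μ) = d/h; this is where n ≥ 1 enters.
  have hdisc := hF.discErr_le_exp hL hR hα hβ hd hd' hm (by
    rw [hdm, mul_div_right_comm, mul_comm _ n]
    exact mul_le_mul_of_nonneg_left (DESinc.q_le_q_mul hn (by positivity)) hμ0.le)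
  have htrunc := hF.truncErr_le hR hα hβ hd hm hdm hM hN hM' hN'
  rw [← mul_assoc] at htrunc
  refine ⟨⟨by rw [hr1], by rw [hr2]⟩, hsum, DESinc.ciSup_le_of_forall_le hdisc,
    DESinc.ciSup_le_of_forall_le htrunc, DESinc.ciSup_le_of_forall_le fun x => ?_⟩
  refine (DESinc.totalErr_le_add F _ x hM hN (hsum x)).trans
    ((add_le_add (hdisc x) (htrunc x)).trans_eq ?_)
  rw [hr1, hr2]
  unfold DESinc.totalConst
  ring
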